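/- **Setting.** Let $\nu$ be a finite nonzero measure on a measurable space $\mathcal X$, let $t:\mathcal X\to\mathbb R^d$ be measurable with $\|t(x)\|_2\le R_2$ for all $x$, and let $p_\theta$ be the exponential family with density $p_\theta(x)=\exp(\theta\cdot t(x)-A(\theta))$ with respect to $\nu$, where $A(\theta)=\log\int e^{\theta\cdot t}\,d\nu$. For data $z_1,\dots,z_n\in\mathcal X$ ($n\ge1$) put $\bar t=\frac1n\sum_i t(z_i)$ and, for $\lambda>0$, $$f(\theta)=-\frac1n\sum_{i=1}^n\log p_\theta(z_i)+\frac\lambda2\|\theta\|_2^2 .$$ Let $L>0$ be a Lipschitz constant of the gradient: $\|f'(\theta)-f'(\phi)\|_2\le L\|\theta-\phi\|_2$ for all $\theta,\phi\in\mathbb R^d$. Let $\Theta\subseteq\mathbb R^d$ be closed and convex, let $\theta_0\in\Theta$ be the starting point, and let $\theta^*\in\arg\min_{\theta\in\Theta}f(\theta)$. For each $\theta$ let $\mathbb M_\theta$ be a Markov transition operator on $\mathcal X$ (depending measurably on $\theta$), and suppose that there are constants $C$ and $0<\alpha<1$ such that for all $\theta\in\Theta$, all probability distributions $q$ on $\mathcal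 X$ and all $v\ge 0$, $$\|\mathbb M_\theta^v q-p_\theta\|_{TV}=\sup_A|(\mathbb M_\theta^v q)(A)-p_\theta(A)|\le C\alpha^v .$$ **Algorithm.** Let $r$ be any probability distribution on $\mathcal X$. For $k=1,\dots,K$: given $\theta_{k-1}$, draw $M$ independent samples $x_1,\dots,x_M\sim\mathbb M_{\theta_{k-1}}^v r$ and set $$\theta_k=\Pi_\Theta\Big[\theta_{k-1}-\frac1L\Big(\frac1M\sum_{i=1}^M t(x_i)-\bar t+\lambda\theta_{k-1}\Big)\Big],$$ where $\Pi_\Theta$ is the Euclidean projection onto $\Theta$. The total work is the number $KMv$ of Markov transitions. **Statement.** Let $\epsilon>0$, $0<\delta<1$, $\beta_1,\beta_2,\beta_3>0$ with $\beta_1+\beta_2+\beta_3=1$. Put $D_0=\|\theta_0-\theta^*\|_2$ and $\bar L=\max\{L,1,\sqrt{2R_2}\}$ (so $\bar L=L$ whenever $L\ge1$ and $L^2\ge2R_2$; in particular whenever $L=4R_2^2+\lambda\ge1$). Define $$\kappa=\frac L\lambda\log\frac{D_0}{\beta_1\epsilon},\qquad \mu(K)=\frac{\bar L^2R_2}{2\epsilon^2\beta_2^2\lambda^2}\Big(1+\sqrt{2\log(K/\delta)}\Big)^2,\qquad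 \eta=\frac1{1-\alpha}\log\frac{2\bar LR_2C}{\beta_3\epsilon\lambda},$$ where $\log 0$ is read as $0$. 1. (Accuracy.) For all integers $K\ge1$, $M\ge1$, $v\ge0$ with $K\ge\kappa$, $M\ge\mu(K)$ and $v\ge\eta$, one has $\|\theta_K-\theta^*\|_2\le\epsilon$ with probability at least $1-\delta$. 2. (Total work.) If $c\ge1$ and the integers $K\ge1$, $M,v\ge0$ satisfy $K\le c\,\kappa$, $M\le c\,\mu(K)$ and $v\le c\,\eta$ (for $c=1$ and equality: $K$, $M$, $v$ meet the schedule exactly), then $$KMv\le c^3\,\frac{L\bar L^2R_2}{2\epsilon^2\beta_2^2\lambda^3(1-\alpha)}\log\Big(\frac{D_0}{\beta_1\epsilon}\Big)\left(1+\sqrt{2\log\Big(\frac{cL}{\lambda\delta}\log\Big(\frac{D_0}{\beta_1\epsilon}\Big)\Big)}\right)^2\log\Big(\frac{2\bar LR_2C}{\beta_3\epsilon\lambda}\Big).$$ Thus, when $\bar L=L$, the work is $O\big((L/\lambda)^3R_2/(\epsilon^2(1-\alpha))\big)$ up to logarithmic factors (the $\beta_i$ being fixed). 3. (Total work after rounding.)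 For the smallest integers that meet the schedule, $K=\max\{1,\lceil\kappa\rceil\}$, $M=\max\{1,\lceil\mu(K)\rceil\}$, $v=\max\{0,\lceil\eta\rceil\}$, $$KMv\le(\kappa^++1)\,\big(\mu(\kappa^++1)+1\big)\,(\eta^++1),\qquad x^+=\max\{0,x\}.$$ -/

import Mathlib

open MeasureTheory ProbabilityTheory

namespace MCMCLearn

/-- Total variation distance `sup_A |p(A) - q(A)|` over the measurable sets `A`. -/
noncomputable def tvDist {X : Type*} [MeasurableSpace X] (p q : Measure X) : ℝ :=
  ⨆ A : {A : Set X // MeasurableSet A}, |p.real A.1 - q.real A.1|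

section ExponentialFamily

/-- The log-partition function `A(θ) = log ∫ exp (θ · t(x)) dν(x)` of the exponential family with
sufficient statistics `t` with respect to the base measure `ν`. -/
noncomputable def logPartition {X : Type*} [MeasurableSpace X] {d : ℕ} (ν : Measure X)
    (t : X → EuclideanSpace ℝ (Fin d)) (θ : EuclideanSpace ℝ (Fin d)) : ℝ :=
  Real.log (∫ x, Real.exp (inner ℝ θ (t x)) ∂ν)

/-- The density `p_θ(x) = exp (θ · t(x) - A(θ))` with respect to the base measure. -/
noncomputable def density {X : Type*} [MeasurableSpace X] {d : ℕ} (ν : Measure X)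
    (t : X → EuclideanSpace ℝ (Fin d)) (θ : EuclideanSpace ℝ (Fin d)) (x : X) : ℝ :=
  Real.exp (inner ℝ θ (t x) - logPartition ν t θ)

/-- The distribution `p_θ`. -/
noncomputable def expFamily {X : Type*} [MeasurableSpace X] {d : ℕ} (ν : Measure X)
    (t : X → EuclideanSpace ℝ (Fin d)) (θ : EuclideanSpace ℝ (Fin d)) : Measure X :=
  ν.withDensity fun x => ENNReal.ofReal (density ν t θ x)

/-- The mean `t̄` of the sufficient statistics over the data `z`. -/
noncomputable def dataMean {X : Type*} {d n : ℕ}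
    (t : X → EuclideanSpace ℝ (Fin d)) (z : Fin n → X) : EuclideanSpace ℝ (Fin d) :=
  (1 / (n : ℝ)) • ∑ i, t (z i)

/-- The ridge-regularized negative log-likelihood
`f(θ) = - (1/n) ∑ log p_θ(z_i) + (λ/2) ‖θ‖²` of the data `z`. -/
noncomputable def regNegLogLik {X : Type*} [MeasurableSpace X] {d n : ℕ} (ν : Measure X)
    (t : X → EuclideanSpace ℝ (Fin d)) (z : Fin n → X) (lam : ℝ)
    (θ : EuclideanSpace ℝ (Fin d)) : ℝ :=
  -(1 / (n : ℝ)) * ∑ i, Real.log (density ν t θ (z i)) + lam / 2 * ‖θ‖ ^ 2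

end ExponentialFamily

section MarkovChain

/-- The distribution `M_θ^v q` of the chain with transition kernel `x ↦ T (θ, x)`, started from
`q`, after `v` transitions. -/
noncomputable def chainLaw {X E : Type*} [MeasurableSpace X] [MeasurableSpace E]
    (T : Kernel (E × X) X) (θ : E) (v : ℕ) (q : Measure X) : Measure X :=
  (fun μ : Measure X => μ.bind (T.sectR θ))^[v] q

theorem chainLaw_succ {X E : Type*} [MeasurableSpace X] [MeasurableSpace E]
    (T : Kernel (E × X) X) (θ : E) (v : ℕ) (q : Measure X) :
    chainLaw T θ (v + 1) q = (chainLaw T θ v q).bind (T.sectR θ) := by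
  simp [chainLaw, Function.iterate_succ_apply']

instance isProbabilityMeasure_chainLaw {X E : Type*} [MeasurableSpace X] [MeasurableSpace E]
    (T : Kernel (E × X) X) [IsMarkovKernel T] (θ : E) (v : ℕ) (q : Measure X)
    [IsProbabilityMeasure q] : IsProbabilityMeasure (chainLaw T θ v q) := by
  induction v with
  | zero => simpa [chainLaw]
  | succ v ih => rw [chainLaw_succ]; infer_instance

theorem measurable_chainLaw {X E : Type*} [MeasurableSpace X] [MeasurableSpace E]
    (T : Kernel (E × X) X) [IsMarkovKernel T] (v : ℕ) (q : Measure X)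
    [IsProbabilityMeasure q] : Measurable fun θ => chainLaw T θ v q := by
  induction v with
  | zero => simp [chainLaw]
  | succ v ih =>
    let κ : Kernel E X := ⟨fun θ => chainLaw T θ v q, ih⟩
    have : IsMarkovKernel κ := ⟨fun θ => isProbabilityMeasure_chainLaw T θ v q⟩
    refine Measure.measurable_of_measurable_coe _ fun s hs => ?_
    have h : ∀ θ, chainLaw T θ (v + 1) q s = ∫⁻ x, T (θ, x) s ∂(κ θ) := fun θ => by
      rw [chainLaw_succ, Measure.bind_apply hs (T.sectR θ).aemeasurable]
      rfl
    simp_rw [h]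
    exact Measurable.lintegral_kernel_prod_right' (T.measurable_coe hs)

/-- The law of `m` independent samples from `M_θ^v r`, as a kernel in `θ`. -/
noncomputable def sampleKernel {X E : Type*} [MeasurableSpace X] [MeasurableSpace E]
    (T : Kernel (E × X) X) [IsMarkovKernel T] (v : ℕ) (r : Measure X) [IsProbabilityMeasure r]
    (m : ℕ) : Kernel E (Fin m → X) where
  toFun θ := Measure.pi fun _ => chainLaw T θ v r
  measurable' := by
    refine Measurable.measure_of_isPiSystem_of_isProbabilityMeasure generateFrom_pi.symm
      isPiSystem_pi ?_
    rintro _ ⟨s, hs, rfl⟩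
    simp_rw [Measure.pi_pi]
    exact Finset.measurable_prod _ fun i _ =>
      (Measure.measurable_coe (hs i trivial)).comp (measurable_chainLaw T v r)

end MarkovChain

section Algorithm

open Classical in
/-- The Euclidean projection `Π_Θ[φ] = argmin_{θ ∈ Θ} ‖θ - φ‖`. It exists and is unique if `Θ` is
nonempty, closed and convex (the value is `φ` if there is no closest point). -/
noncomputable def proj {d : ℕ} (Θ : Set (EuclideanSpace ℝ (Fin d)))
    (φ : EuclideanSpace ℝ (Fin d)) : EuclideanSpace ℝ (Fin d) :=
  if h : ∃ θ ∈ Θ, ∀ y ∈ Θ, ‖θ - φ‖ ≤ ‖y - φ‖ then h.choose else φ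

/-- The approximate gradient `(1/m) ∑ t(x_i) - t̄ + λ θ` computed from the samples `x`. -/
noncomputable def gradEstimate {X : Type*} {d n m : ℕ}
    (t : X → EuclideanSpace ℝ (Fin d)) (z : Fin n → X) (lam : ℝ)
    (θ : EuclideanSpace ℝ (Fin d)) (x : Fin m → X) : EuclideanSpace ℝ (Fin d) :=
  (1 / (m : ℝ)) • (∑ i, t (x i)) - dataMean t z + lam • θ

/-- One step of projected gradient descent with step size `1 / L`. -/
noncomputable def update {X : Type*} {d n m : ℕ}
    (t : X → EuclideanSpace ℝ (Fin d)) (z : Fin n → X) (lam L : ℝ)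
    (Θ : Set (EuclideanSpace ℝ (Fin d))) (θ : EuclideanSpace ℝ (Fin d)) (x : Fin m → X) :
    EuclideanSpace ℝ (Fin d) :=
  proj Θ (θ - (1 / L) • gradEstimate t z lam θ x)

/-- The law of the iterate `θ_k` of the algorithm started at `θ₀`: given `θ_{k-1}`, draw `m`
independent samples `x_1, …, x_m` from `M_{θ_{k-1}}^v r`, and update. -/
noncomputable def iterateLaw {X : Type*} [MeasurableSpace X] {d n : ℕ}
    (t : X → EuclideanSpace ℝ (Fin d)) (z : Fin n → X) (lam L : ℝ)
    (Θ : Set (EuclideanSpace ℝ (Fin d)))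
    (T : Kernel (EuclideanSpace ℝ (Fin d) × X) X) [IsMarkovKernel T]
    (r : Measure X) [IsProbabilityMeasure r] (m v : ℕ) (θ₀ : EuclideanSpace ℝ (Fin d)) :
    ℕ → Measure (EuclideanSpace ℝ (Fin d))
  | 0 => Measure.dirac θ₀
  | k + 1 =>
    (iterateLaw t z lam L Θ T r m v θ₀ k ⊗ₘ sampleKernel T v r m).map
      fun y => update t z lam L Θ y.1 y.2

end Algorithm

section Schedule

/-- `(L/λ) log (‖θ₀ - θ*‖ / (β₁ ε))`, where `D₀` stands for `‖θ₀ - θ*‖`. -/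
noncomputable def stepBound (L lam D₀ β₁ ε : ℝ) : ℝ :=
  L / lam * Real.log (D₀ / (β₁ * ε))

/-- `ℓ² R₂ / (2 ε² β₂² λ²) · (1 + √(2 log (K/δ)))²`. -/
noncomputable def sampleBound (l R₂ lam β₂ ε δ K : ℝ) : ℝ :=
  l ^ 2 * R₂ / (2 * ε ^ 2 * β₂ ^ 2 * lam ^ 2) * (1 + √(2 * Real.log (K / δ))) ^ 2

/-- `(1/(1-α)) log (2 ℓ R₂ C / (β₃ ε λ))`. -/
noncomputable def transitionBound (l R₂ lam β₃ ε C α : ℝ) : ℝ :=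
  1 / (1 - α) * Real.log (2 * l * R₂ * C / (β₃ * ε * lam))

/-- The constant `max {L, 1, √(2 R₂)}`, which equals `L` as soon as `1 ≤ L` and `2 R₂ ≤ L²`. -/
noncomputable def effLip (L R₂ : ℝ) : ℝ :=
  max L (max 1 √(2 * R₂))

end Schedule

end MCMCLearn

/-!
The objective `f` is `λ`-strongly convex and has an `L`-Lipschitz gradient, so a gradient step of
size `1 / L` contracts by `1 - λ / L`; this is the cocoercivity of the gradient of
`f - (λ / 2) ‖·‖ ^ 2`. The projection onto `Θ` is nonexpansive and `θ*` is a fixed point of the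
exact projected step, hence each step with an approximate gradient satisfies
`‖θ_k - θ*‖ ≤ (1 - λ / L) ‖θ_{k-1} - θ*‖ + (1 / L) ‖error of the gradient‖`.

The error of the gradient is the deviation of a sample mean of `t` from the mean of `t` under
`p_θ`. Its bias is at most `2 R₂` times the distance in total variation between the law of the
chain and `p_θ`. The sampling noise has mean at most `R₂ / √M` by orthogonality of the centred
samples, and it exceeds `(R₂ / √M) (1 + √(2 log (K / δ)))` with probability at most `δ / K` by
McDiarmid's inequality. If every error is at most `λ b`, then the ball of radius
`(1 - λ / L) ^ k D₀ + b` around `θ*` contains `θ_k`, and a union bound over the `K` steps costs a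
failure probability of `δ`. The three schedules make the initial error, the noise and the bias
contribute at most `β₁ ε`, `β₂ ε` and `β₃ ε`.
-/

namespace MCMCLearn

section Optimization

variable {E : Type*} [NormedAddCommGroup E] [InnerProductSpace ℝ E]
  {f : E → ℝ} {g : E → E} {c L : ℝ}

/-- `f` lies above its quadratic models of curvature `c` with slopes `g`. For `g` the gradient of
`f` this is `c`-strong convexity (convexity if `c = 0`); differentiability is not part of the
notion. -/
def HasQuadraticLowerModel (c : ℝ) (f : E → ℝ) (g : E → E) : Prop :=
  ∀ x y, f x + inner ℝ (g x) (y - x) + c / 2 * ‖y - x‖ ^ 2 ≤ f y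

/-- `f` lies below its quadratic models of curvature `L` with slopes `g`, as a function with
`L`-Lipschitz gradient `g` does. -/
def HasQuadraticUpperModel (L : ℝ) (f : E → ℝ) (g : E → E) : Prop :=
  ∀ x y, f y ≤ f x + inner ℝ (g x) (y - x) + L / 2 * ‖y - x‖ ^ 2

theorem hasDerivAt_comp_segment [CompleteSpace E] (hg : ∀ x, HasGradientAt f (g x) x)
    (x u : E) (s : ℝ) :
    HasDerivAt (fun s : ℝ => f (x + s • u)) (inner ℝ (g (x + s • u)) u) s := by
  have hline : HasDerivAt (fun s : ℝ => x + s • u) u s := by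
    simpa using ((hasDerivAt_id s).smul_const u).const_add x
  simpa [Function.comp_def] using (hg (x + s • u)).hasFDerivAt.comp_hasDerivAt s hline

theorem hasQuadraticUpperModel_of_norm_gradient_sub_le [CompleteSpace E]
    (hg : ∀ x, HasGradientAt f (g x) x) (hL : ∀ x y, ‖g x - g y‖ ≤ L * ‖x - y‖) :
    HasQuadraticUpperModel L f g := by
  intro x y
  set u := y - x with hu
  let ψ : ℝ → ℝ := fun s => f (x + s • u) - (s * inner ℝ (g x) u + s ^ 2 * (L / 2 * ‖u‖ ^ 2))
  have hψ (s : ℝ) : HasDerivAt ψ (inner ℝ (g (x + s • u) - g x) u - s * (L * ‖u‖ ^ 2)) s := by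
    refine ((hasDerivAt_comp_segment hg x u s).sub
      (((hasDerivAt_id s).mul_const _).add ((hasDerivAt_pow 2 s).mul_const _))).congr_deriv ?_
    rw [inner_sub_left]
    push_cast
    ring
  have hslope (s : ℝ) (hs : 0 ≤ s) : inner ℝ (g (x + s • u) - g x) u ≤ s * (L * ‖u‖ ^ 2) :=
    calc inner ℝ (g (x + s • u) - g x) u
        ≤ ‖g (x + s • u) - g x‖ * ‖u‖ := real_inner_le_norm _ _
      _ ≤ L * ‖x + s • u - x‖ * ‖u‖ := by gcongr; exact hL _ _
      _ = s * (L * ‖u‖ ^ 2) := by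
        rw [add_sub_cancel_left, norm_smul, Real.norm_of_nonneg hs]
        ring
  have hanti : AntitoneOn ψ (Set.Icc 0 1) := by
    refine antitoneOn_of_deriv_nonpos (convex_Icc 0 1)
      (fun s _ => (hψ s).continuousAt.continuousWithinAt)
      (fun s _ => (hψ s).differentiableAt.differentiableWithinAt) fun s hs => ?_
    rw [interior_Icc] at hs
    rw [(hψ s).deriv, sub_nonpos]
    exact hslope s hs.1.le
  have hends : ψ 1 ≤ ψ 0 :=
    hanti (Set.left_mem_Icc.2 zero_le_one) (Set.right_mem_Icc.2 zero_le_one) zero_le_one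
  have hy : x + (1 : ℝ) • u = y := by rw [hu, one_smul, add_sub_cancel]
  simp only [ψ, hy, zero_smul, add_zero] at hends
  linarith

theorem HasQuadraticLowerModel.sub_half_mul_norm_sq (h : HasQuadraticLowerModel c f g) (a : ℝ) :
    HasQuadraticLowerModel (c - a) (fun x => f x - a / 2 * ‖x‖ ^ 2) (fun x => g x - a • x) := by
  intro x y
  have hxy := h x y
  have hsq : ‖y‖ ^ 2 = ‖x‖ ^ 2 + 2 * inner ℝ x (y - x) + ‖y - x‖ ^ 2 := by
    rw [← norm_add_sq_real, add_sub_cancel]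
  simp only [hsq, inner_sub_left, real_inner_smul_left]
  linarith

theorem HasQuadraticUpperModel.sub_half_mul_norm_sq (h : HasQuadraticUpperModel L f g) (a : ℝ) :
    HasQuadraticUpperModel (L - a) (fun x => f x - a / 2 * ‖x‖ ^ 2) (fun x => g x - a • x) := by
  intro x y
  have hxy := h x y
  have hsq : ‖y‖ ^ 2 = ‖x‖ ^ 2 + 2 * inner ℝ x (y - x) + ‖y - x‖ ^ 2 := by
    rw [← norm_add_sq_real, add_sub_cancel]
  simp only [hsq, inner_sub_left, real_inner_smul_left]
  linarith

theorem HasQuadraticLowerModel.le_of_hasQuadraticUpperModel [Nontrivial E]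
    (hlow : HasQuadraticLowerModel c f g) (hup : HasQuadraticUpperModel L f g) : c ≤ L := by
  obtain ⟨u, hu⟩ := exists_norm_eq E zero_le_one
  have h := (hlow 0 u).trans (hup 0 u)
  rw [sub_zero, hu] at h
  linarith

/- The lower model at `x` and the upper model at `y` are compared at `y - s • (g y - g x)`; for
`s = 1 / L` this point minimises the upper model of `f - inner (g x) ·` at `y`. -/
theorem HasQuadraticLowerModel.add_mul_norm_sub_sq_le (hlow : HasQuadraticLowerModel 0 f g)
    (hup : HasQuadraticUpperModel L f g) (s : ℝ) (x y : E) :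
    f x + inner ℝ (g x) (y - x) + (s - L / 2 * s ^ 2) * ‖g y - g x‖ ^ 2 ≤ f y := by
  set D := g y - g x with hD
  have hx := hlow x (y - s • D)
  have hy := hup y (y - s • D)
  rw [show y - s • D - x = y - x - s • D by abel, inner_sub_right, inner_smul_right] at hx
  rw [sub_sub_cancel_left, norm_neg, norm_smul, mul_pow, Real.norm_eq_abs, sq_abs,
    inner_neg_right, inner_smul_right] at hy
  have hDD : inner ℝ (g y) D - inner ℝ (g x) D = ‖D‖ ^ 2 := by
    rw [← inner_sub_left, ← hD, real_inner_self_eq_norm_sq]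
  linear_combination hx + hy - s * hDD

theorem HasQuadraticLowerModel.norm_sub_sq_le_mul_inner (hlow : HasQuadraticLowerModel 0 f g)
    (hup : HasQuadraticUpperModel L f g) (hL : 0 ≤ L) (x y : E) :
    ‖g x - g y‖ ^ 2 ≤ L * inner ℝ (g x - g y) (x - y) := by
  have hstep (s : ℝ) :
      (2 * s - L * s ^ 2) * ‖g x - g y‖ ^ 2 ≤ inner ℝ (g x - g y) (x - y) := by
    have hxy := hlow.add_mul_norm_sub_sq_le hup s x y
    have hyx := hlow.add_mul_norm_sub_sq_le hup s y x
    rw [norm_sub_rev (g y), ← neg_sub x y, inner_neg_right] at hxy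
    rw [inner_sub_left]
    linarith
  have hgt : ∀ l > L, ‖g x - g y‖ ^ 2 ≤ l * inner ℝ (g x - g y) (x - y) := by
    intro l hl
    have hl₀ : 0 < l := hL.trans_lt hl
    have hcoeff : 1 ≤ l * (2 * (1 / l) - L * (1 / l) ^ 2) := by
      have : L / l ≤ 1 := (div_le_one hl₀).2 hl.le
      field_simp
      linarith
    calc ‖g x - g y‖ ^ 2
        ≤ l * (2 * (1 / l) - L * (1 / l) ^ 2) * ‖g x - g y‖ ^ 2 :=
          le_mul_of_one_le_left (sq_nonneg _) hcoeff
      _ ≤ l * inner ℝ (g x - g y) (x - y) := by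
          rw [mul_assoc]
          exact mul_le_mul_of_nonneg_left (hstep _) hl₀.le
  have hlim : Filter.Tendsto (fun l => l * inner ℝ (g x - g y) (x - y)) (nhdsWithin L (Set.Ioi L))
      (nhds (L * inner ℝ (g x - g y) (x - y))) :=
    ((continuous_mul_const _).tendsto L).mono_left nhdsWithin_le_nhds
  exact ge_of_tendsto hlim (eventually_nhdsWithin_of_forall hgt)

/- Cocoercivity is applied to `f - c / 2 * ‖·‖ ^ 2`, whose models have curvatures `0` and
`L - c`. -/
theorem HasQuadraticLowerModel.norm_gradient_step_sub_le (hlow : HasQuadraticLowerModel c f g)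
    (hup : HasQuadraticUpperModel L f g) (hL : 0 < L) (hcL : c ≤ L) (x y : E) :
    ‖(x - (1 / L) • g x) - (y - (1 / L) • g y)‖ ≤ (1 - c / L) * ‖x - y‖ := by
  have hlow₀ := hlow.sub_half_mul_norm_sq c
  rw [sub_self] at hlow₀
  have hco := hlow₀.norm_sub_sq_le_mul_inner (hup.sub_half_mul_norm_sq c) (sub_nonneg.2 hcL) x y
  set D := g x - c • x - (g y - c • y) with hD
  have hρ : 0 ≤ 1 - c / L := sub_nonneg.2 ((div_le_one hL).2 hcL)
  have hsplit : (x - (1 / L) • g x) - (y - (1 / L) • g y)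
      = (1 - c / L) • (x - y) - (1 / L) • D := by
    rw [hD]
    module
  rw [hsplit]
  refine le_of_sq_le_sq ?_ (by positivity)
  calc ‖(1 - c / L) • (x - y) - (1 / L) • D‖ ^ 2
      = ((1 - c / L) * ‖x - y‖) ^ 2
        - (2 * ((L - c) * inner ℝ D (x - y)) - ‖D‖ ^ 2) / L ^ 2 := by
        rw [norm_sub_sq_real, norm_smul, norm_smul, real_inner_smul_left, real_inner_smul_right,
          Real.norm_of_nonneg hρ, Real.norm_of_nonneg (by positivity), real_inner_comm]
        field_simp
        ring
    _ ≤ ((1 - c / L) * ‖x - y‖) ^ 2 := by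
        refine sub_le_self _ (div_nonneg ?_ (sq_nonneg L))
        linarith [sq_nonneg ‖D‖]

theorem inner_gradient_sub_nonneg_of_isMinOn [CompleteSpace E] {v x : E} {s : Set E}
    (hg : HasGradientAt f v x) (hs : Convex ℝ s) (hx : x ∈ s) (hmin : IsMinOn f s x) {y : E}
    (hy : y ∈ s) : 0 ≤ inner ℝ v (y - x) := by
  have h := hmin.localize.hasFDerivWithinAt_nonneg (y := y - x)
    hg.hasFDerivAt.hasFDerivWithinAt
    (sub_mem_posTangentConeAt_of_segment_subset (hs.segment_subset hx hy))
  simpa using h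

end Optimization

section Projection

theorem norm_sub_le_of_inner_sub_nonpos {E : Type*} [NormedAddCommGroup E] [InnerProductSpace ℝ E]
    {φ ψ a b : E} (ha : inner ℝ (φ - a) (b - a) ≤ 0) (hb : inner ℝ (ψ - b) (a - b) ≤ 0) :
    ‖a - b‖ ≤ ‖φ - ψ‖ := by
  have hsq : ‖a - b‖ * ‖a - b‖ ≤ ‖φ - ψ‖ * ‖a - b‖ :=
    calc ‖a - b‖ * ‖a - b‖
        = inner ℝ (φ - ψ) (a - b) + (inner ℝ (φ - a) (b - a) + inner ℝ (ψ - b) (a - b)) := by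
          rw [← neg_sub a b, inner_neg_right, ← real_inner_self_eq_norm_mul_norm]
          simp only [inner_sub_left]
          ring
      _ ≤ inner ℝ (φ - ψ) (a - b) := by linarith
      _ ≤ ‖φ - ψ‖ * ‖a - b‖ := real_inner_le_norm _ _
  rcases (norm_nonneg (a - b)).eq_or_lt with hab | hab
  · exact hab ▸ norm_nonneg _
  · exact le_of_mul_le_mul_right hsq hab

variable {d : ℕ} {Θ : Set (EuclideanSpace ℝ (Fin d))}

theorem proj_spec (hΘ : IsClosed Θ) (hne : Θ.Nonempty) (φ : EuclideanSpace ℝ (Fin d)) :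
    proj Θ φ ∈ Θ ∧ ∀ w ∈ Θ, ‖proj Θ φ - φ‖ ≤ ‖w - φ‖ := by
  have hex : ∃ θ ∈ Θ, ∀ w ∈ Θ, ‖θ - φ‖ ≤ ‖w - φ‖ := by
    obtain ⟨θ, hθ, hdist⟩ := hΘ.exists_infDist_eq_dist hne φ
    refine ⟨θ, hθ, fun w hw => ?_⟩
    rw [← dist_eq_norm, ← dist_eq_norm, dist_comm, ← hdist, dist_comm]
    exact Metric.infDist_le_dist_of_mem hw
  rw [proj, dif_pos hex]
  exact hex.choose_spec

theorem proj_mem (hΘ : IsClosed Θ) (hne : Θ.Nonempty) (φ : EuclideanSpace ℝ (Fin d)) :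
    proj Θ φ ∈ Θ :=
  (proj_spec hΘ hne φ).1

theorem inner_sub_proj_nonpos (hΘ : IsClosed Θ) (hconv : Convex ℝ Θ)
    (φ : EuclideanSpace ℝ (Fin d)) {w : EuclideanSpace ℝ (Fin d)} (hw : w ∈ Θ) :
    inner ℝ (φ - proj Θ φ) (w - proj Θ φ) ≤ 0 := by
  obtain ⟨hmem, hle⟩ := proj_spec hΘ ⟨w, hw⟩ φ
  refine (norm_eq_iInf_iff_real_inner_le_zero hconv hmem).1 ?_ w hw
  have : Nonempty Θ := ⟨⟨_, hmem⟩⟩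
  refine le_antisymm (le_ciInf fun u => ?_)
    (ciInf_le ⟨0, Set.forall_mem_range.2 fun _ => norm_nonneg _⟩ (⟨_, hmem⟩ : Θ))
  rw [norm_sub_rev, norm_sub_rev φ]
  exact hle u u.2

theorem norm_proj_sub_proj_le (hΘ : IsClosed Θ) (hconv : Convex ℝ Θ) (hne : Θ.Nonempty)
    (φ ψ : EuclideanSpace ℝ (Fin d)) : ‖proj Θ φ - proj Θ ψ‖ ≤ ‖φ - ψ‖ :=
  norm_sub_le_of_inner_sub_nonpos
    (inner_sub_proj_nonpos hΘ hconv φ (proj_mem hΘ hne ψ))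
    (inner_sub_proj_nonpos hΘ hconv ψ (proj_mem hΘ hne φ))

theorem norm_proj_sub_le (hΘ : IsClosed Θ) (hconv : Convex ℝ Θ)
    {θ φ : EuclideanSpace ℝ (Fin d)} (hθ : θ ∈ Θ) (h : ∀ w ∈ Θ, inner ℝ (φ - θ) (w - θ) ≤ 0)
    (ψ : EuclideanSpace ℝ (Fin d)) : ‖proj Θ ψ - θ‖ ≤ ‖ψ - φ‖ :=
  norm_sub_le_of_inner_sub_nonpos (inner_sub_proj_nonpos hΘ hconv ψ hθ)
    (h _ (proj_mem hΘ ⟨θ, hθ⟩ ψ))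

theorem continuous_proj (hΘ : IsClosed Θ) (hconv : Convex ℝ Θ) (hne : Θ.Nonempty) :
    Continuous (proj Θ) := by
  refine (LipschitzWith.of_dist_le_mul (K := 1) fun φ ψ => ?_).continuous
  simpa [dist_eq_norm] using norm_proj_sub_proj_le hΘ hconv hne φ ψ

end Projection

section BoundedDifferences

/-- McDiarmid's condition: changing the `i`-th coordinate changes `F` by at most `c i`. -/
def HasBoundedDifferences {ι : Type*} {X : ι → Type*} (F : (∀ i, X i) → ℝ) (c : ι → ℝ) : Prop :=
  ∀ i x y, (∀ j, j ≠ i → x j = y j) → |F x - F y| ≤ c i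

theorem HasBoundedDifferences.abs_sub_le_sum {ι : Type*} [Fintype ι] {X : ι → Type*}
    {F : (∀ i, X i) → ℝ} {c : ι → ℝ} (hF : HasBoundedDifferences F c) (x y : ∀ i, X i) :
    |F x - F y| ≤ ∑ i, c i := by
  classical
  have hchange (s : Finset ι) : |F (s.piecewise x y) - F y| ≤ ∑ i ∈ s, c i := by
    induction s using Finset.induction_on with
    | empty => simp
    | insert i s hi ih =>
      have hone : |F ((insert i s).piecewise x y) - F (s.piecewise x y)| ≤ c i := by
        refine hF i _ _ fun j hj => ?_
        rw [Finset.piecewise_insert, Function.update_of_ne hj]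
      rw [Finset.sum_insert hi]
      exact (abs_sub_le _ (F (s.piecewise x y)) _).trans (add_le_add hone ih)
  simpa using hchange Finset.univ

theorem HasBoundedDifferences.comp_insertNth {m : ℕ} {X : Fin (m + 1) → Type*}
    {F : (∀ i, X i) → ℝ} {c : Fin (m + 1) → ℝ} (hF : HasBoundedDifferences F c) (p : Fin (m + 1))
    (a : X p) :
    HasBoundedDifferences (fun x => F (p.insertNth a x)) fun j => c (p.succAbove j) := by
  refine fun j x y hxy => hF _ _ _ fun k hk => ?_
  rcases Fin.eq_self_or_eq_succAbove p k with rfl | ⟨i, rfl⟩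
  · simp only [Fin.insertNth_apply_same]
  · simp only [Fin.insertNth_apply_succAbove]
    exact hxy i fun hij => hk (by rw [hij])

theorem HasBoundedDifferences.abs_insertNth_sub_insertNth_le {m : ℕ} {X : Fin (m + 1) → Type*}
    {F : (∀ i, X i) → ℝ} {c : Fin (m + 1) → ℝ} (hF : HasBoundedDifferences F c) (p : Fin (m + 1))
    (a b : X p) (x : ∀ j, X (p.succAbove j)) :
    |F (p.insertNth a x) - F (p.insertNth b x)| ≤ c p := by
  refine hF p _ _ fun k hk => ?_
  obtain ⟨i, rfl⟩ := Fin.exists_succAbove_eq hk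
  simp only [Fin.insertNth_apply_succAbove]

variable {X Y : Type*} [MeasurableSpace X] [MeasurableSpace Y]

theorem hasSubgaussianMGF_sub_integral_of_abs_sub_le {μ : Measure X} [IsProbabilityMeasure μ]
    {f : X → ℝ} (hf : Measurable f) {c : NNReal} (hc : ∀ x y, |f x - f y| ≤ c) :
    HasSubgaussianMGF (fun x => f x - ∫ y, f y ∂μ) ((c / 2) ^ 2) μ := by
  have : Nonempty X := μ.nonempty_of_neZero
  have hle (x y : X) : f x - c ≤ f y := by linarith [(abs_le.1 (hc x y)).2]
  have hbdd : BddBelow (Set.range f) :=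
    ⟨f (Classical.arbitrary X) - c, Set.forall_mem_range.2 (hle _)⟩
  have hmem (x : X) : f x ∈ Set.Icc (⨅ y, f y) ((⨅ y, f y) + c) :=
    ⟨ciInf_le hbdd x, by linarith [le_ciInf (hle x)]⟩
  simpa using hasSubgaussianMGF_of_mem_Icc (μ := μ) hf.aemeasurable (.of_forall hmem)

theorem hasSubgaussianMGF_prod {μ : Measure X} {ν : Measure Y} [SFinite μ] [SFinite ν]
    {F : X × Y → ℝ} (hF : Measurable F) {g : X → ℝ} {e : ℝ} {a b : NNReal}
    (hg : HasSubgaussianMGF (fun x => g x - e) a μ)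
    (hFg : ∀ x, HasSubgaussianMGF (fun y => F (x, y) - g x) b ν) :
    HasSubgaussianMGF (fun p => F p - e) (a + b) (μ.prod ν) := by
  have hsplit (s : ℝ) (x : X) (y : Y) : Real.exp (s * (F (x, y) - e))
      = Real.exp (s * (g x - e)) * Real.exp (s * (F (x, y) - g x)) := by
    rw [← Real.exp_add]
    ring_nf
  have hinner (s : ℝ) (x : X) : ∫ y, Real.exp (s * (F (x, y) - e)) ∂ν
      ≤ Real.exp (s * (g x - e)) * Real.exp (b * s ^ 2 / 2) := by
    simp_rw [hsplit, integral_const_mul]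
    exact mul_le_mul_of_nonneg_left ((hFg x).mgf_le s) (Real.exp_pos _).le
  have hmeas (s : ℝ) : Measurable fun p => Real.exp (s * (F p - e)) := by fun_prop
  have hdom (s : ℝ) : Integrable
      (fun x => Real.exp (s * (g x - e)) * Real.exp (b * s ^ 2 / 2)) μ :=
    (hg.integrable_exp_mul s).mul_const _
  have hint (s : ℝ) : Integrable (fun p => Real.exp (s * (F p - e))) (μ.prod ν) := by
    refine (integrable_prod_iff (hmeas s).aestronglyMeasurable).2
      ⟨.of_forall fun x => ?_, (hdom s).mono' ?_ (.of_forall fun x => ?_)⟩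
    · simp_rw [hsplit]
      exact ((hFg x).integrable_exp_mul s).const_mul _
    · exact (hmeas s).norm.stronglyMeasurable.integral_prod_right'.aestronglyMeasurable
    · simp_rw [Real.norm_of_nonneg (Real.exp_pos _).le]
      rw [Real.norm_of_nonneg (integral_nonneg fun y => (Real.exp_pos _).le)]
      exact hinner s x
  refine ⟨hint, fun s => ?_⟩
  calc mgf (fun p => F p - e) (μ.prod ν) s
      = ∫ x, ∫ y, Real.exp (s * (F (x, y) - e)) ∂ν ∂μ := integral_prod _ (hint s)
    _ ≤ ∫ x, Real.exp (s * (g x - e)) * Real.exp (b * s ^ 2 / 2) ∂μ :=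
        integral_mono (hint s).integral_prod_left (hdom s) (hinner s)
    _ ≤ Real.exp (a * s ^ 2 / 2) * Real.exp (b * s ^ 2 / 2) := by
        rw [integral_mul_const]
        exact mul_le_mul_of_nonneg_right (hg.mgf_le s) (Real.exp_pos _).le
    _ = Real.exp (↑(a + b) * s ^ 2 / 2) := by
        rw [← Real.exp_add]
        push_cast
        ring_nf

theorem hasSubgaussianMGF_prod_of_abs_sub_le {μ : Measure X} {ν : Measure Y}
    [IsProbabilityMeasure μ] [IsProbabilityMeasure ν] {F : X × Y → ℝ} (hF : Measurable F)
    {c b : NNReal} {B : ℝ} (hB : ∀ p q, |F p - F q| ≤ B)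
    (hc : ∀ x x' y, |F (x, y) - F (x', y)| ≤ c)
    (hFY : ∀ x, HasSubgaussianMGF (fun y => F (x, y) - ∫ y', F (x, y') ∂ν) b ν) :
    HasSubgaussianMGF (fun p => F p - ∫ q, F q ∂μ.prod ν) ((c / 2) ^ 2 + b) (μ.prod ν) := by
  have hint : Integrable F (μ.prod ν) := by
    obtain ⟨p₀⟩ := (μ.prod ν).nonempty_of_neZero
    refine .of_bound hF.aestronglyMeasurable (|F p₀| + B) (.of_forall fun p => ?_)
    rw [Real.norm_eq_abs]
    linarith [abs_sub_abs_le_abs_sub (F p) (F p₀), hB p p₀]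
  have hintY (x : X) : Integrable (fun y => F (x, y)) ν := by
    simpa [Pi.add_def] using (hFY x).integrable.add (integrable_const (∫ y', F (x, y') ∂ν))
  rw [integral_prod _ hint]
  refine hasSubgaussianMGF_prod hF (hasSubgaussianMGF_sub_integral_of_abs_sub_le
    hF.stronglyMeasurable.integral_prod_right'.measurable fun x x' => ?_) hFY
  rw [← integral_sub (hintY x) (hintY x')]
  simpa using norm_integral_le_of_norm_le_const (μ := ν) (f := fun y => F (x, y) - F (x', y))
    (.of_forall (hc x x'))

theorem HasBoundedDifferences.hasSubgaussianMGF {m : ℕ} {X : Fin m → Type*}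
    [∀ i, MeasurableSpace (X i)] (μ : ∀ i, Measure (X i)) [∀ i, IsProbabilityMeasure (μ i)]
    {F : (∀ i, X i) → ℝ} {c : Fin m → NNReal} (hF : Measurable F)
    (hc : HasBoundedDifferences F fun i => c i) :
    HasSubgaussianMGF (fun x => F x - ∫ y, F y ∂Measure.pi μ) (∑ i, (c i / 2) ^ 2)
      (Measure.pi μ) := by
  induction m with
  | zero =>
    have hconst : F = fun _ => F default := funext fun x => congrArg F (Subsingleton.elim _ _)
    rw [hconst]
    simp
  | succ m ih =>
    let e := MeasurableEquiv.piFinSuccAbove X 0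
    have he : MeasurePreserving e (Measure.pi μ)
        ((μ 0).prod (Measure.pi fun j => μ (Fin.succAbove 0 j))) :=
      measurePreserving_piFinSuccAbove μ 0
    have hFe : Measurable (F ∘ e.symm) := hF.comp e.symm.measurable
    have hprod := hasSubgaussianMGF_prod_of_abs_sub_le (μ := μ 0) hFe
      (fun _ _ => hc.abs_sub_le_sum _ _) (hc.abs_insertNth_sub_insertNth_le 0)
      fun a => ih (fun j => μ (Fin.succAbove 0 j)) (hFe.comp measurable_prodMk_left)
        (hc.comp_insertNth 0 a)
    rw [← he.map_eq] at hprod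
    have hpi := hprod.of_map he.measurable.aemeasurable
    rw [he.map_eq, ← he.integral_comp e.measurableEmbedding] at hpi
    rw [Fin.sum_univ_succAbove _ 0]
    simpa only [Function.comp_def, e.symm_apply_apply] using hpi

end BoundedDifferences

section SampleMean

variable {X E : Type*} [NormedAddCommGroup E] [NormedSpace ℝ E] {m : ℕ} {t : X → E} {R : ℝ}

/-- The sample mean `(1/m) ∑ t(x_i)` of the statistic `t` over the sample `x`. -/
noncomputable def sampleMean (t : X → E) (x : Fin m → X) : E :=
  (1 / (m : ℝ)) • ∑ i, t (x i)

theorem norm_sampleMean_le (hR₀ : 0 ≤ R) (hR : ∀ x, ‖t x‖ ≤ R) (x : Fin m → X) :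
    ‖sampleMean t x‖ ≤ R := by
  have hsum : ‖∑ i, t (x i)‖ ≤ m * R := by
    simpa using norm_sum_le_of_le Finset.univ fun i _ => hR (x i)
  rw [sampleMean, norm_smul, Real.norm_of_nonneg (by positivity), one_div]
  exact inv_mul_le_of_le_mul₀ m.cast_nonneg hR₀ hsum

theorem sampleMean_sub_const (hm : m ≠ 0) (a : E) (x : Fin m → X) :
    sampleMean (fun y => t y - a) x = sampleMean t x - a := by
  have hm' : (m : ℝ) ≠ 0 := Nat.cast_ne_zero.2 hm
  simp [sampleMean, smul_sub, ← Nat.cast_smul_eq_nsmul ℝ, smul_smul, hm']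

theorem hasBoundedDifferences_norm_sampleMean_sub (hR : ∀ x, ‖t x‖ ≤ R) (a : E) :
    HasBoundedDifferences (fun x : Fin m → X => ‖sampleMean t x - a‖) fun _ => 2 * R / m := by
  intro i x y hxy
  have hdiff : sampleMean t x - sampleMean t y = (1 / (m : ℝ)) • (t (x i) - t (y i)) := by
    rw [sampleMean, sampleMean, ← smul_sub, ← Finset.sum_sub_distrib,
      Finset.sum_eq_single_of_mem i (Finset.mem_univ i)]
    intro j _ hj
    rw [hxy j hj, sub_self]
  calc |‖sampleMean t x - a‖ - ‖sampleMean t y - a‖|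
      ≤ ‖sampleMean t x - a - (sampleMean t y - a)‖ := abs_norm_sub_norm_le _ _
    _ = 1 / m * ‖t (x i) - t (y i)‖ := by
        rw [sub_sub_sub_cancel_right, hdiff, norm_smul, Real.norm_of_nonneg (by positivity)]
    _ ≤ 1 / m * (R + R) := by
        gcongr
        exact norm_sub_le_of_le (hR _) (hR _)
    _ = 2 * R / m := by ring

variable [MeasurableSpace X] [MeasurableSpace E] [BorelSpace E] [SecondCountableTopology E]

theorem measurable_sampleMean (ht : Measurable t) :
    Measurable fun x : Fin m → X => sampleMean t x := by
  unfold sampleMean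
  fun_prop

theorem measureReal_integral_add_le_norm_sampleMean_sub_le (P : Measure X)
    [IsProbabilityMeasure P] (ht : Measurable t) (hR₀ : 0 < R) (hR : ∀ x, ‖t x‖ ≤ R)
    (hm : m ≠ 0) (a : E) {s : ℝ} (hs : 0 ≤ s) :
    (Measure.pi fun _ => P).real {x : Fin m → X |
      ∫ x' : Fin m → X, ‖sampleMean t x' - a‖ ∂Measure.pi (fun _ => P) + R / √m * s
        ≤ ‖sampleMean t x - a‖} ≤ Real.exp (-(s ^ 2 / 2)) := by
  lift R to NNReal using hR₀.le
  have hm' : (0 : ℝ) < m := Nat.cast_pos.2 (Nat.pos_of_ne_zero hm)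
  have hdiff : HasBoundedDifferences (fun x : Fin m → X => ‖sampleMean t x - a‖)
      fun _ => ((2 * R / m : NNReal) : ℝ) := by
    simpa using hasBoundedDifferences_norm_sampleMean_sub hR a
  have htail := (hdiff.hasSubgaussianMGF (fun _ => P)
    ((measurable_sampleMean ht).sub_const a).norm).measure_ge_le
      (ε := R / √m * s) (by positivity)
  have hexponent : -(R / √m * s) ^ 2
      / (2 * ((∑ _ : Fin m, (2 * R / m / 2) ^ 2 : NNReal) : ℝ)) = -(s ^ 2 / 2) := by
    rw [mul_pow, div_pow, Real.sq_sqrt hm'.le]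
    simp only [Finset.sum_const, Finset.card_univ, Fintype.card_fin, nsmul_eq_mul]
    push_cast
    field_simp
  simp_rw [le_sub_iff_add_le'] at htail
  rwa [hexponent] at htail

end SampleMean

section Concentration

variable {E : Type*} [NormedAddCommGroup E] [InnerProductSpace ℝ E]

theorem integrable_inner_of_memLp_two {Ω : Type*} [MeasurableSpace Ω] {P : Measure Ω}
    {ξ ζ : Ω → E} (hξ : MemLp ξ 2 P) (hζ : MemLp ζ 2 P) :
    Integrable (fun ω => inner ℝ (ξ ω) (ζ ω)) P :=
  (hξ.norm.integrable_mul hζ.norm).mono' (hξ.1.inner hζ.1)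
    (.of_forall fun _ => norm_inner_le_norm _ _)

variable [CompleteSpace E]

theorem integral_norm_sub_integral_sq_le {Ω : Type*} [MeasurableSpace Ω] {P : Measure Ω}
    [IsProbabilityMeasure P] {ξ : Ω → E} (hξ : MemLp ξ 2 P) :
    ∫ ω, ‖ξ ω - ∫ ω', ξ ω' ∂P‖ ^ 2 ∂P ≤ ∫ ω, ‖ξ ω‖ ^ 2 ∂P := by
  have hint := hξ.integrable one_le_two
  set a := ∫ ω, ξ ω ∂P with ha
  have hexpand (ω : Ω) : ‖ξ ω - a‖ ^ 2 = ‖ξ ω‖ ^ 2 - (2 * inner ℝ a (ξ ω) - ‖a‖ ^ 2) := by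
    rw [norm_sub_sq_real, real_inner_comm]
    ring
  have hcross : Integrable (fun ω => 2 * inner ℝ a (ξ ω)) P := (hint.const_inner a).const_mul 2
  have hcross' : Integrable (fun ω => 2 * inner ℝ a (ξ ω) - ‖a‖ ^ 2) P :=
    hcross.sub (integrable_const _)
  simp_rw [hexpand]
  rw [integral_sub ((memLp_two_iff_integrable_sq_norm hξ.1).1 hξ) hcross',
    integral_sub hcross (integrable_const _), integral_const_mul, integral_inner hint, ← ha,
    real_inner_self_eq_norm_sq, integral_const, probReal_univ, one_smul]
  linarith [sq_nonneg ‖a‖]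

variable [MeasurableSpace E] [BorelSpace E]

theorem integral_norm_sum_sq_of_indepFun {Ω ι : Type*} [MeasurableSpace Ω] {P : Measure Ω}
    [IsFiniteMeasure P] {ξ : ι → Ω → E} {s : Finset ι} (hmem : ∀ i ∈ s, MemLp (ξ i) 2 P)
    (hmean : ∀ i ∈ s, ∫ ω, ξ i ω ∂P = 0)
    (hindep : ∀ i ∈ s, ∀ j ∈ s, i ≠ j → ξ i ⟂ᵢ[P] ξ j) :
    ∫ ω, ‖∑ i ∈ s, ξ i ω‖ ^ 2 ∂P = ∑ i ∈ s, ∫ ω, ‖ξ i ω‖ ^ 2 ∂P := by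
  have hint : ∀ i ∈ s, ∀ j ∈ s, Integrable (fun ω => inner ℝ (ξ i ω) (ξ j ω)) P :=
    fun i hi j hj => integrable_inner_of_memLp_two (hmem i hi) (hmem j hj)
  have horth : ∀ i ∈ s, ∀ j ∈ s, j ≠ i → ∫ ω, inner ℝ (ξ i ω) (ξ j ω) ∂P = 0 := by
    intro i hi j hj hij
    have h := (hindep i hi j hj hij.symm).integral_bilin ((hmem i hi).integrable one_le_two)
      ((hmem j hj).integrable one_le_two) (innerSL ℝ)
    rwa [hmean i hi, map_zero, zero_apply] at h
  simp_rw [← real_inner_self_eq_norm_sq, sum_inner, inner_sum]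
  rw [integral_finsetSum _ fun i hi => integrable_finsetSum _ (hint i hi)]
  refine Finset.sum_congr rfl fun i hi => ?_
  rw [integral_finsetSum _ (hint i hi)]
  exact Finset.sum_eq_single_of_mem i hi (horth i hi)

theorem integral_norm_le_sqrt_integral_norm_sq {Ω F : Type*} [MeasurableSpace Ω]
    [NormedAddCommGroup F] {P : Measure Ω} [IsProbabilityMeasure P] {ξ : Ω → F}
    (hξ : MemLp ξ 2 P) : ∫ ω, ‖ξ ω‖ ∂P ≤ √(∫ ω, ‖ξ ω‖ ^ 2 ∂P) := by
  refine Real.le_sqrt_of_sq_le ?_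
  have h := variance_nonneg (fun ω => ‖ξ ω‖) P
  rw [variance_eq_sub hξ.norm] at h
  exact sub_nonneg.1 h

variable {X : Type*} [MeasurableSpace X] [SecondCountableTopology E] {t : X → E} {m : ℕ} {R : ℝ}
  (P : Measure X) [IsProbabilityMeasure P]

theorem integral_norm_sum_sq_pi {h : X → E} (hh : Measurable h) (hmem : MemLp h 2 P)
    (hmean : ∫ y, h y ∂P = 0) :
    ∫ x : Fin m → X, ‖∑ i, h (x i)‖ ^ 2 ∂Measure.pi (fun _ => P) = m * ∫ y, ‖h y‖ ^ 2 ∂P := by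
  have hindep : iIndepFun (fun (i : Fin m) (x : Fin m → X) => h (x i)) (Measure.pi fun _ => P) :=
    iIndepFun_pi (X := fun _ => h) fun _ => hh.aemeasurable
  have hmem' (i : Fin m) : MemLp (fun x : Fin m → X => h (x i)) 2 (Measure.pi fun _ => P) :=
    hmem.comp_measurePreserving (measurePreserving_eval (fun _ : Fin m => P) i)
  have hmean' (i : Fin m) : ∫ x : Fin m → X, h (x i) ∂Measure.pi (fun _ => P) = 0 :=
    (integral_comp_eval (μ := fun _ => P) hmem.1).trans hmean
  have hsq (i : Fin m) : ∫ x : Fin m → X, ‖h (x i)‖ ^ 2 ∂Measure.pi (fun _ => P)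
      = ∫ y, ‖h y‖ ^ 2 ∂P :=
    integral_comp_eval (μ := fun _ => P) (f := fun y => ‖h y‖ ^ 2) (by fun_prop)
  rw [integral_norm_sum_sq_of_indepFun (fun i _ => hmem' i) (fun i _ => hmean' i)
    fun i _ j _ hij => hindep.indepFun hij]
  simp only [hsq, Finset.sum_const, Finset.card_univ, Fintype.card_fin, nsmul_eq_mul]

theorem integral_norm_sampleMean_sub_sq_le (ht : Measurable t) (hmem : MemLp t 2 P)
    (hm : m ≠ 0) :
    ∫ x : Fin m → X, ‖sampleMean t x - ∫ y, t y ∂P‖ ^ 2 ∂Measure.pi (fun _ => P)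
      ≤ (∫ y, ‖t y‖ ^ 2 ∂P) / m := by
  have hm' : (m : ℝ) ≠ 0 := Nat.cast_ne_zero.2 hm
  set a := ∫ y, t y ∂P with ha
  have hmean : ∫ y, (t y - a) ∂P = 0 := by
    rw [integral_sub (hmem.integrable one_le_two) (integrable_const a), integral_const,
      probReal_univ, one_smul, ← ha, sub_self]
  have hdev (x : Fin m → X) :
      ‖sampleMean t x - a‖ ^ 2 = (1 / m) ^ 2 * ‖∑ i, (t (x i) - a)‖ ^ 2 := by
    rw [← sampleMean_sub_const hm, sampleMean, norm_smul, mul_pow,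
      Real.norm_of_nonneg (by positivity)]
  calc ∫ x : Fin m → X, ‖sampleMean t x - a‖ ^ 2 ∂Measure.pi (fun _ => P)
      = (1 / m) ^ 2 * (m * ∫ y, ‖t y - a‖ ^ 2 ∂P) := by
        simp_rw [hdev]
        rw [integral_const_mul, integral_norm_sum_sq_pi P (ht.sub_const a)
          (hmem.sub (memLp_const a)) hmean]
    _ = (∫ y, ‖t y - a‖ ^ 2 ∂P) / m := by field_simp
    _ ≤ (∫ y, ‖t y‖ ^ 2 ∂P) / m :=
        div_le_div_of_nonneg_right (integral_norm_sub_integral_sq_le hmem) m.cast_nonneg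

theorem integral_norm_sampleMean_sub_le (ht : Measurable t) (hR₀ : 0 ≤ R) (hR : ∀ x, ‖t x‖ ≤ R)
    (hm : m ≠ 0) :
    ∫ x : Fin m → X, ‖sampleMean t x - ∫ y, t y ∂P‖ ∂Measure.pi (fun _ => P) ≤ R / √m := by
  have hmem : MemLp t 2 P := .of_bound ht.aestronglyMeasurable R (.of_forall hR)
  have hmemMean : MemLp (fun x : Fin m → X => sampleMean t x - ∫ y, t y ∂P) 2
      (Measure.pi fun _ => P) :=
    .sub (.of_bound (measurable_sampleMean ht).aestronglyMeasurable R
      (.of_forall (norm_sampleMean_le hR₀ hR))) (memLp_const _)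
  have hsq : ∫ y, ‖t y‖ ^ 2 ∂P ≤ R ^ 2 := by
    have h := integral_mono ((memLp_two_iff_integrable_sq_norm hmem.1).1 hmem)
      (integrable_const (R ^ 2)) fun y => pow_le_pow_left₀ (norm_nonneg _) (hR y) 2
    rwa [integral_const, probReal_univ, one_smul] at h
  calc ∫ x : Fin m → X, ‖sampleMean t x - ∫ y, t y ∂P‖ ∂Measure.pi (fun _ => P)
      ≤ √((∫ y, ‖t y‖ ^ 2 ∂P) / m) := (integral_norm_le_sqrt_integral_norm_sq hmemMean).trans
        (Real.sqrt_le_sqrt (integral_norm_sampleMean_sub_sq_le P ht hmem hm))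
    _ ≤ √(R ^ 2 / m) := by gcongr
    _ = R / √m := by rw [Real.sqrt_div (sq_nonneg R), Real.sqrt_sq hR₀]

theorem measureReal_lt_norm_sampleMean_sub_le (ht : Measurable t) (hR : ∀ x, ‖t x‖ ≤ R)
    (hm : m ≠ 0) {p : ℝ} (hp : 0 < p) :
    (Measure.pi fun _ => P).real {x : Fin m → X |
      R / √m * (1 + √(2 * Real.log (1 / p))) < ‖sampleMean t x - ∫ y, t y ∂P‖} ≤ p := by
  rcases le_or_gt 1 p with hp1 | hp1
  · exact measureReal_le_one.trans hp1
  obtain ⟨x₀⟩ := P.nonempty_of_neZero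
  rcases ((norm_nonneg _).trans (hR x₀)).eq_or_lt with rfl | hR₀
  · have ht₀ : t = 0 := funext fun x => norm_le_zero_iff.1 (hR x)
    simpa [ht₀, sampleMean] using hp.le
  have hlog : 0 < Real.log (1 / p) := Real.log_pos ((one_lt_div hp).2 hp1)
  have hmean := integral_norm_sampleMean_sub_le P ht hR₀.le hR hm
  calc (Measure.pi fun _ => P).real {x : Fin m → X |
        R / √m * (1 + √(2 * Real.log (1 / p))) < ‖sampleMean t x - ∫ y, t y ∂P‖}
      ≤ _ := measureReal_mono fun x hx => by
        rw [Set.mem_ofPred_eq, mul_add, mul_one] at hx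
        exact (add_le_add_left hmean _).trans hx.le
    _ ≤ Real.exp (-(√(2 * Real.log (1 / p)) ^ 2 / 2)) :=
        measureReal_integral_add_le_norm_sampleMean_sub_le P ht hR₀ hR hm _ (Real.sqrt_nonneg _)
    _ = p := by
        rw [Real.sq_sqrt (by positivity), mul_div_cancel_left₀ _ two_ne_zero, one_div,
          Real.log_inv, neg_neg, Real.exp_log hp]

end Concentration

section TotalVariation

variable {X : Type*} [MeasurableSpace X]

theorem measureReal_sub_le_tvDist (P Q : Measure X) [IsFiniteMeasure P] [IsFiniteMeasure Q]
    {A : Set X} (hA : MeasurableSet A) : P.real A - Q.real A ≤ tvDist P Q := by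
  have hbdd : BddAbove (Set.range fun A : {A : Set X // MeasurableSet A} =>
      |P.real A.1 - Q.real A.1|) := by
    refine ⟨max (P.real Set.univ) (Q.real Set.univ), Set.forall_mem_range.2 fun B => ?_⟩
    exact abs_sub_le_of_nonneg_of_le measureReal_nonneg
      (le_max_of_le_left (measureReal_mono (Set.subset_univ _))) measureReal_nonneg
      (le_max_of_le_right (measureReal_mono (Set.subset_univ _)))
  exact (le_abs_self _).trans (le_ciSup hbdd ⟨A, hA⟩)

theorem integrableOn_measureReal_le (P : Measure X) [IsFiniteMeasure P] (f : X → ℝ) (B : ℝ) :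
    IntegrableOn (fun s => P.real {x | s ≤ f x}) (Set.Ioc 0 B) := by
  have hanti : Antitone fun s => P.real {x | s ≤ f x} :=
    fun s s' hs => measureReal_mono fun x hx => hs.trans hx
  exact ((hanti.antitoneOn _).integrableOn_isCompact isCompact_Icc).mono_set
    Set.Ioc_subset_Icc_self

theorem integral_sub_integral_le_mul_tvDist_of_nonneg (P Q : Measure X) [IsFiniteMeasure P]
    [IsFiniteMeasure Q] {f : X → ℝ} (hf : Measurable f) {B : ℝ} (hB : 0 ≤ B)
    (hfB : ∀ x, f x ∈ Set.Icc 0 B) : ∫ x, f x ∂P - ∫ x, f x ∂Q ≤ B * tvDist P Q := by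
  have hlayer (μ : Measure X) [IsFiniteMeasure μ] :
      ∫ x, f x ∂μ = ∫ s in Set.Ioc 0 B, μ.real {x | s ≤ f x} :=
    (Integrable.of_mem_Icc 0 B hf.aemeasurable (.of_forall hfB)).integral_eq_integral_Ioc_meas_le
      (.of_forall fun x => (hfB x).1) (.of_forall fun x => (hfB x).2)
  have hintP := integrableOn_measureReal_le P f B
  have hintQ := integrableOn_measureReal_le Q f B
  calc ∫ x, f x ∂P - ∫ x, f x ∂Q
      = ∫ s in Set.Ioc 0 B, (P.real {x | s ≤ f x} - Q.real {x | s ≤ f x}) := by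
        rw [integral_sub hintP hintQ, ← hlayer P, ← hlayer Q]
    _ ≤ ∫ _ in Set.Ioc 0 B, tvDist P Q :=
        integral_mono (hintP.sub hintQ) (integrable_const _) fun s =>
          measureReal_sub_le_tvDist P Q (measurableSet_le measurable_const hf)
    _ = B * tvDist P Q := by simp [hB]

variable (P Q : Measure X) [IsProbabilityMeasure P] [IsProbabilityMeasure Q]

theorem integral_sub_integral_le_mul_tvDist {f : X → ℝ} (hf : Measurable f) {a b : ℝ}
    (hfab : ∀ x, f x ∈ Set.Icc a b) : ∫ x, f x ∂P - ∫ x, f x ∂Q ≤ (b - a) * tvDist P Q := by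
  obtain ⟨x₀⟩ := P.nonempty_of_neZero
  have hshift (μ : Measure X) [IsProbabilityMeasure μ] :
      ∫ x, (f x - a) ∂μ = ∫ x, f x ∂μ - a := by
    rw [integral_sub (.of_mem_Icc a b hf.aemeasurable (.of_forall hfab)) (integrable_const a),
      integral_const, probReal_univ, one_smul]
  have h := integral_sub_integral_le_mul_tvDist_of_nonneg P Q (hf.sub_const a)
    (sub_nonneg.2 ((hfab x₀).1.trans (hfab x₀).2))
    fun x => ⟨sub_nonneg.2 (hfab x).1, sub_le_sub_right (hfab x).2 a⟩
  rwa [hshift P, hshift Q, sub_sub_sub_cancel_right] at h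

theorem norm_integral_sub_integral_le_mul_tvDist {E : Type*} [NormedAddCommGroup E]
    [NormedSpace ℝ E] [CompleteSpace E] [SecondCountableTopology E] [MeasurableSpace E]
    [BorelSpace E] {t : X → E} (ht : Measurable t) {R : ℝ} (hR : ∀ x, ‖t x‖ ≤ R) :
    ‖∫ x, t x ∂P - ∫ x, t x ∂Q‖ ≤ 2 * R * tvDist P Q := by
  have hint (μ : Measure X) [IsProbabilityMeasure μ] : Integrable t μ :=
    .of_bound ht.aestronglyMeasurable R (.of_forall hR)
  obtain ⟨g, hg, hgu⟩ := exists_dual_vector'' ℝ (∫ x, t x ∂P - ∫ x, t x ∂Q)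
  have hgt (x : X) : g (t x) ∈ Set.Icc (-R) R :=
    abs_le.1 (((g.le_of_opNorm_le hg _).trans_eq (one_mul _)).trans (hR x))
  calc ‖∫ x, t x ∂P - ∫ x, t x ∂Q‖
      = ∫ x, g (t x) ∂P - ∫ x, g (t x) ∂Q := by
        rw [g.integral_comp_comm (hint P), g.integral_comp_comm (hint Q), ← map_sub, hgu]
        rfl
    _ ≤ (R - -R) * tvDist P Q :=
        integral_sub_integral_le_mul_tvDist P Q (g.continuous.measurable.comp ht) hgt
    _ = 2 * R * tvDist P Q := by ring

end TotalVariation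

section PartitionFunction

variable {X E : Type*} [MeasurableSpace X] [NormedAddCommGroup E] [InnerProductSpace ℝ E]
  [SecondCountableTopology E] [MeasurableSpace E] [BorelSpace E] {ν : Measure X}
  [IsFiniteMeasure ν] {t : X → E} {R : ℝ}

theorem integrable_exp_inner (ht : Measurable t) (hR : ∀ x, ‖t x‖ ≤ R) (θ : E) :
    Integrable (fun x => Real.exp (inner ℝ θ (t x))) ν := by
  refine .of_bound (by fun_prop) (Real.exp (‖θ‖ * R)) (.of_forall fun x => ?_)
  rw [Real.norm_of_nonneg (Real.exp_pos _).le]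
  exact Real.exp_le_exp.2 ((real_inner_le_norm _ _).trans
    (mul_le_mul_of_nonneg_left (hR x) (norm_nonneg _)))

theorem hasFDerivAt_integral_exp_inner (ht : Measurable t) (hR : ∀ x, ‖t x‖ ≤ R) (θ : E) :
    HasFDerivAt (fun φ => ∫ x, Real.exp (inner ℝ φ (t x)) ∂ν)
      (∫ x, Real.exp (inner ℝ θ (t x)) • innerSL ℝ (t x) ∂ν) θ := by
  have hbound (x : X) (φ : E) (hφ : φ ∈ Metric.ball θ 1) :
      ‖Real.exp (inner ℝ φ (t x)) • innerSL ℝ (t x)‖ ≤ Real.exp ((‖θ‖ + 1) * R) * R := by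
    have hφ' : ‖φ‖ ≤ ‖θ‖ + 1 := by
      linarith [norm_le_norm_add_norm_sub' φ θ, mem_ball_iff_norm.1 hφ]
    rw [norm_smul, Real.norm_of_nonneg (Real.exp_pos _).le, innerSL_apply_norm]
    gcongr
    · exact (real_inner_le_norm _ _).trans
        (mul_le_mul hφ' (hR x) (norm_nonneg _) (by positivity))
    · exact hR x
  have hderiv (x : X) (φ : E) : HasFDerivAt (fun φ => Real.exp (inner ℝ φ (t x)))
      (Real.exp (inner ℝ φ (t x)) • innerSL ℝ (t x)) φ := by
    have hinner : HasFDerivAt (fun φ : E => inner ℝ φ (t x)) (innerSL ℝ (t x)) φ :=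
      (innerSL ℝ (t x)).hasFDerivAt.congr_of_eventuallyEq
        (.of_forall fun ψ => by simp only [innerSL_apply_apply, real_inner_comm])
    exact hinner.exp
  have hmeas :
      AEStronglyMeasurable (fun x => Real.exp (inner ℝ θ (t x)) • innerSL ℝ (t x)) ν :=
    (integrable_exp_inner ht hR θ).1.smul
      ((innerSL ℝ).continuous.comp_aestronglyMeasurable ht.aestronglyMeasurable)
  exact hasFDerivAt_integral_of_dominated_of_fderiv_le (Metric.ball_mem_nhds θ one_pos)
    (.of_forall fun φ => (integrable_exp_inner ht hR φ).1) (integrable_exp_inner ht hR θ)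
    hmeas (.of_forall hbound) (integrable_const _)
    (.of_forall fun x φ _ => hderiv x φ)

theorem hasGradientAt_integral_exp_inner [CompleteSpace E] (ht : Measurable t)
    (hR : ∀ x, ‖t x‖ ≤ R) (θ : E) :
    HasGradientAt (fun φ => ∫ x, Real.exp (inner ℝ φ (t x)) ∂ν)
      (∫ x, Real.exp (inner ℝ θ (t x)) • t x ∂ν) θ := by
  have hint : Integrable (fun x => Real.exp (inner ℝ θ (t x)) • t x) ν :=
    (integrable_exp_inner ht hR θ).smul_bdd R ht.aestronglyMeasurable (.of_forall hR)
  have h := hasFDerivAt_integral_exp_inner (ν := ν) ht hR θ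
  simp_rw [← map_smul] at h
  rwa [(innerSL ℝ).integral_comp_comm hint] at h

end PartitionFunction

section ExponentialFamilyCalculus

variable {X : Type*} [MeasurableSpace X] {d n : ℕ} {ν : Measure X}
  {t : X → EuclideanSpace ℝ (Fin d)} {R lam L : ℝ}

theorem regNegLogLik_eq (hn : 0 < n) (z : Fin n → X) (θ : EuclideanSpace ℝ (Fin d)) :
    regNegLogLik ν t z lam θ
      = logPartition ν t θ - inner ℝ (dataMean t z) θ + lam / 2 * ‖θ‖ ^ 2 := by
  have hn' : (n : ℝ) ≠ 0 := Nat.cast_ne_zero.2 hn.ne'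
  simp only [regNegLogLik, density, Real.log_exp, dataMean, Finset.sum_sub_distrib,
    real_inner_smul_left, sum_inner, Finset.sum_const, Finset.card_univ, Fintype.card_fin,
    nsmul_eq_mul]
  simp_rw [real_inner_comm θ]
  field_simp
  ring

variable [IsFiniteMeasure ν] [NeZero ν]

theorem expFamily_eq_tilted (ht : Measurable t) (hR : ∀ x, ‖t x‖ ≤ R)
    (θ : EuclideanSpace ℝ (Fin d)) :
    expFamily ν t θ = ν.tilted fun x => inner ℝ θ (t x) := by
  have hpos := integral_exp_pos (integrable_exp_inner (ν := ν) ht hR θ)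
  simp only [expFamily, Measure.tilted, density, logPartition, Real.exp_sub, Real.exp_log hpos]

theorem isProbabilityMeasure_expFamily (ht : Measurable t) (hR : ∀ x, ‖t x‖ ≤ R)
    (θ : EuclideanSpace ℝ (Fin d)) : IsProbabilityMeasure (expFamily ν t θ) := by
  rw [expFamily_eq_tilted ht hR]
  exact isProbabilityMeasure_tilted (integrable_exp_inner ht hR θ)

theorem hasGradientAt_logPartition (ht : Measurable t) (hR : ∀ x, ‖t x‖ ≤ R)
    (θ : EuclideanSpace ℝ (Fin d)) :
    HasGradientAt (logPartition ν t) (∫ x, t x ∂(expFamily ν t θ)) θ := by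
  have hpos := integral_exp_pos (integrable_exp_inner (ν := ν) ht hR θ)
  rw [expFamily_eq_tilted ht hR, integral_tilted]
  simp_rw [div_eq_inv_mul, mul_smul]
  rw [integral_smul, hasGradientAt_iff_hasFDerivAt, map_smul]
  exact (hasGradientAt_integral_exp_inner ht hR θ).hasFDerivAt.log hpos.ne'

/- Jensen's inequality for `exp`: the ratio of the partition functions at `φ` and at `θ` is the
mean of `exp ⟪φ - θ, t⟫` under `p_θ`. -/
theorem hasQuadraticLowerModel_logPartition (ht : Measurable t) (hR : ∀ x, ‖t x‖ ≤ R) :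
    HasQuadraticLowerModel 0 (logPartition ν t) fun θ => ∫ x, t x ∂(expFamily ν t θ) := by
  intro θ φ
  have hprob := isProbabilityMeasure_expFamily (ν := ν) ht hR θ
  have hint : Integrable t (expFamily ν t θ) :=
    .of_bound ht.aestronglyMeasurable R (.of_forall hR)
  have hpos (ψ : EuclideanSpace ℝ (Fin d)) : 0 < ∫ x, Real.exp (inner ℝ ψ (t x)) ∂ν :=
    integral_exp_pos (integrable_exp_inner ht hR ψ)
  have hratio : ∫ x, Real.exp (inner ℝ (φ - θ) (t x)) ∂(expFamily ν t θ)
      = (∫ x, Real.exp (inner ℝ φ (t x)) ∂ν) / ∫ x, Real.exp (inner ℝ θ (t x)) ∂ν := by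
    rw [expFamily_eq_tilted ht hR, integral_exp_tilted]
    simp only [Pi.add_apply, ← inner_add_left, add_sub_cancel]
  have hjensen : Real.exp (inner ℝ (φ - θ) (∫ x, t x ∂(expFamily ν t θ)))
      ≤ ∫ x, Real.exp (inner ℝ (φ - θ) (t x)) ∂(expFamily ν t θ) := by
    rw [← integral_inner hint]
    exact convexOn_exp.map_integral_le Real.continuous_exp.continuousOn isClosed_univ
      (.of_forall fun _ => Set.mem_univ _) (hint.const_inner _) (integrable_exp_inner ht hR _)
  rw [hratio, ← Real.le_log_iff_exp_le (div_pos (hpos φ) (hpos θ)),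
    Real.log_div (hpos φ).ne' (hpos θ).ne', real_inner_comm] at hjensen
  simp only [logPartition]
  linarith

/-- The gradient field of `regNegLogLik`, as the excess of the model mean of the sufficient
statistics over their data mean, plus the gradient of the penalty. -/
noncomputable def regGradient (ν : Measure X) (t : X → EuclideanSpace ℝ (Fin d)) (z : Fin n → X)
    (lam : ℝ) (θ : EuclideanSpace ℝ (Fin d)) : EuclideanSpace ℝ (Fin d) :=
  ∫ x, t x ∂(expFamily ν t θ) - dataMean t z + lam • θ

theorem hasGradientAt_regNegLogLik (ht : Measurable t) (hR : ∀ x, ‖t x‖ ≤ R) (hn : 0 < n)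
    (z : Fin n → X) (lam : ℝ) (θ : EuclideanSpace ℝ (Fin d)) :
    HasGradientAt (regNegLogLik ν t z lam) (regGradient ν t z lam θ) θ := by
  have hpenalty := (hasStrictFDerivAt_norm_sq θ).hasFDerivAt.const_mul (lam / 2)
  have hsum := ((hasGradientAt_logPartition (ν := ν) ht hR θ).hasFDerivAt.sub
    (innerSL ℝ (dataMean t z)).hasFDerivAt).add hpenalty
  rw [hasGradientAt_iff_hasFDerivAt, funext (regNegLogLik_eq (ν := ν) (t := t) hn z)]
  refine hsum.congr_fderiv (ContinuousLinearMap.ext fun u => ?_)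
  simp [regGradient]
  ring

theorem hasQuadraticLowerModel_regNegLogLik (ht : Measurable t) (hR : ∀ x, ‖t x‖ ≤ R)
    (hn : 0 < n) (z : Fin n → X) (lam : ℝ) :
    HasQuadraticLowerModel lam (regNegLogLik ν t z lam) (regGradient ν t z lam) := by
  intro θ φ
  have h := hasQuadraticLowerModel_logPartition (ν := ν) ht hR θ φ
  rw [regNegLogLik_eq hn, regNegLogLik_eq hn, regGradient, norm_sub_sq_real, inner_add_left,
    inner_sub_left, real_inner_smul_left, inner_sub_right (dataMean t z), inner_sub_right θ,
    real_inner_self_eq_norm_sq, real_inner_comm θ φ]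
  linarith

theorem hasQuadraticUpperModel_regNegLogLik (ht : Measurable t) (hR : ∀ x, ‖t x‖ ≤ R)
    (hn : 0 < n) (z : Fin n → X)
    (hLip : ∀ θ φ : EuclideanSpace ℝ (Fin d), ‖gradient (regNegLogLik ν t z lam) θ -
      gradient (regNegLogLik ν t z lam) φ‖ ≤ L * ‖θ - φ‖) :
    HasQuadraticUpperModel L (regNegLogLik ν t z lam) (regGradient ν t z lam) := by
  have hg := hasGradientAt_regNegLogLik (ν := ν) ht hR hn z lam
  refine hasQuadraticUpperModel_of_norm_gradient_sub_le hg fun θ φ => ?_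
  rw [← (hg θ).gradient, ← (hg φ).gradient]
  exact hLip θ φ

end ExponentialFamilyCalculus

section ProjectedGradientStep

variable {d : ℕ} {Θ : Set (EuclideanSpace ℝ (Fin d))} {c L : ℝ}

theorem norm_proj_gradient_step_sub_le {f : EuclideanSpace ℝ (Fin d) → ℝ}
    {g : EuclideanSpace ℝ (Fin d) → EuclideanSpace ℝ (Fin d)}
    {θs : EuclideanSpace ℝ (Fin d)} (hg : HasGradientAt f (g θs) θs)
    (hlow : HasQuadraticLowerModel c f g) (hup : HasQuadraticUpperModel L f g) (hL : 0 < L)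
    (hcL : c ≤ L) (hΘc : IsClosed Θ) (hΘ : Convex ℝ Θ) (hθs : θs ∈ Θ) (hmin : IsMinOn f Θ θs)
    (θ u : EuclideanSpace ℝ (Fin d)) :
    ‖proj Θ (θ - (1 / L) • (g θ + u)) - θs‖ ≤ (1 - c / L) * ‖θ - θs‖ + 1 / L * ‖u‖ := by
  have hopt (w) (hw : w ∈ Θ) : inner ℝ (θs - (1 / L) • g θs - θs) (w - θs) ≤ 0 := by
    rw [sub_sub_cancel_left, inner_neg_left, real_inner_smul_left, neg_nonpos]
    exact mul_nonneg (by positivity) (inner_gradient_sub_nonneg_of_isMinOn hg hΘ hθs hmin hw)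
  calc ‖proj Θ (θ - (1 / L) • (g θ + u)) - θs‖
      ≤ ‖θ - (1 / L) • (g θ + u) - (θs - (1 / L) • g θs)‖ :=
        norm_proj_sub_le hΘc hΘ hθs hopt _
    _ = ‖(θ - (1 / L) • g θ - (θs - (1 / L) • g θs)) - (1 / L) • u‖ := by
        congr 1
        module
    _ ≤ ‖θ - (1 / L) • g θ - (θs - (1 / L) • g θs)‖ + ‖(1 / L) • u‖ := norm_sub_le _ _
    _ ≤ (1 - c / L) * ‖θ - θs‖ + 1 / L * ‖u‖ := by
        rw [norm_smul, Real.norm_of_nonneg (by positivity : 0 ≤ 1 / L)]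
        gcongr
        exact hlow.norm_gradient_step_sub_le hup hL hcL θ θs

variable {X : Type*} [MeasurableSpace X] {n m : ℕ} {ν : Measure X}
  {t : X → EuclideanSpace ℝ (Fin d)} {z : Fin n → X} {lam : ℝ}

theorem gradEstimate_eq (θ : EuclideanSpace ℝ (Fin d)) (x : Fin m → X) :
    gradEstimate t z lam θ x
      = regGradient ν t z lam θ + (sampleMean t x - ∫ y, t y ∂(expFamily ν t θ)) := by
  simp only [gradEstimate, regGradient, sampleMean]
  abel

theorem norm_update_sub_le {θs : EuclideanSpace ℝ (Fin d)}
    (hg : HasGradientAt (regNegLogLik ν t z lam) (regGradient ν t z lam θs) θs)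
    (hlow : HasQuadraticLowerModel lam (regNegLogLik ν t z lam) (regGradient ν t z lam))
    (hup : HasQuadraticUpperModel L (regNegLogLik ν t z lam) (regGradient ν t z lam))
    (hL : 0 < L) (hle : lam ≤ L) (hΘc : IsClosed Θ) (hΘ : Convex ℝ Θ) (hθs : θs ∈ Θ)
    (hmin : IsMinOn (regNegLogLik ν t z lam) Θ θs) (θ : EuclideanSpace ℝ (Fin d))
    (x : Fin m → X) :
    ‖update t z lam L Θ θ x - θs‖ ≤ (1 - lam / L) * ‖θ - θs‖
      + 1 / L * ‖sampleMean t x - ∫ y, t y ∂(expFamily ν t θ)‖ := by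
  rw [update, gradEstimate_eq (ν := ν)]
  exact norm_proj_gradient_step_sub_le hg hlow hup hL hle hΘc hΘ hθs hmin θ _

end ProjectedGradientStep

section Iterates

theorem measureReal_map_compProd_compl_le {E Y : Type*} [MeasurableSpace E] [MeasurableSpace Y]
    (μ : Measure E) [IsProbabilityMeasure μ] (κ : Kernel E Y) [IsMarkovKernel κ] {U : E × Y → E}
    (hU : Measurable U) {S S' : Set E} (hS : MeasurableSet S) (hS' : MeasurableSet S') {p : ℝ}
    (hp : 0 ≤ p) (h : ∀ a ∈ S, (κ a).real {y | U (a, y) ∉ S'} ≤ p) :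
    ((μ ⊗ₘ κ).map U).real S'ᶜ ≤ μ.real Sᶜ + p := by
  have hpt (a : E) :
      κ a (Prod.mk a ⁻¹' (U ⁻¹' S'ᶜ)) ≤ Sᶜ.indicator 1 a + ENNReal.ofReal p := by
    by_cases ha : a ∈ S
    · exact le_add_left ((ENNReal.le_ofReal_iff_toReal_le (measure_ne_top _ _) hp).2 (h a ha))
    · rw [Set.indicator_of_mem (Set.mem_compl ha)]
      exact le_add_right prob_le_one
  have hle : ((μ ⊗ₘ κ).map U) S'ᶜ ≤ μ Sᶜ + ENNReal.ofReal p :=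
    calc ((μ ⊗ₘ κ).map U) S'ᶜ
        = ∫⁻ a, κ a (Prod.mk a ⁻¹' (U ⁻¹' S'ᶜ)) ∂μ := by
          rw [Measure.map_apply hU hS'.compl, Measure.compProd_apply (hU hS'.compl)]
      _ ≤ ∫⁻ a, Sᶜ.indicator 1 a + ENNReal.ofReal p ∂μ := lintegral_mono hpt
      _ = μ Sᶜ + ENNReal.ofReal p := by
          rw [lintegral_add_right _ measurable_const, lintegral_indicator_one hS.compl,
            lintegral_const, measure_univ, mul_one]
  have hreal := ENNReal.toReal_mono (by finiteness) hle
  rwa [ENNReal.toReal_add (by finiteness) (by finiteness), ENNReal.toReal_ofReal hp] at hreal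

variable {X : Type*} [MeasurableSpace X] {d n m v : ℕ} {t : X → EuclideanSpace ℝ (Fin d)}
  {z : Fin n → X} {lam L : ℝ} {Θ : Set (EuclideanSpace ℝ (Fin d))}

instance isMarkovKernel_sampleKernel {E : Type*} [MeasurableSpace E] (T : Kernel (E × X) X)
    [IsMarkovKernel T] (v : ℕ) (r : Measure X) [IsProbabilityMeasure r] (m : ℕ) :
    IsMarkovKernel (sampleKernel T v r m) :=
  ⟨fun θ => inferInstanceAs (IsProbabilityMeasure (Measure.pi fun _ => chainLaw T θ v r))⟩

theorem measurable_update (ht : Measurable t) (hΘc : IsClosed Θ) (hΘ : Convex ℝ Θ)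
    (hne : Θ.Nonempty) :
    Measurable fun y : EuclideanSpace ℝ (Fin d) × (Fin m → X) =>
      update t z lam L Θ y.1 y.2 := by
  have hmean : Measurable fun y : EuclideanSpace ℝ (Fin d) × (Fin m → X) =>
      sampleMean t y.2 := (measurable_sampleMean ht).comp measurable_snd
  have hestimate := (hmean.sub_const (dataMean t z)).add (measurable_fst.const_smul lam)
  exact (continuous_proj hΘc hΘ hne).measurable.comp
    (measurable_fst.sub (hestimate.const_smul (1 / L)))

variable {T : Kernel (EuclideanSpace ℝ (Fin d) × X) X} [IsMarkovKernel T]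
  {r : Measure X} [IsProbabilityMeasure r] {θ₀ : EuclideanSpace ℝ (Fin d)} {p : ℝ}

theorem isProbabilityMeasure_iterateLaw (ht : Measurable t) (hΘc : IsClosed Θ)
    (hΘ : Convex ℝ Θ) (hne : Θ.Nonempty) (k : ℕ) :
    IsProbabilityMeasure (iterateLaw t z lam L Θ T r m v θ₀ k) := by
  induction k with
  | zero => exact Measure.dirac.isProbabilityMeasure
  | succ k ih =>
    exact Measure.isProbabilityMeasure_map (measurable_update ht hΘc hΘ hne).aemeasurable

theorem measureReal_iterateLaw_compl_le (ht : Measurable t) (hΘc : IsClosed Θ)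
    (hΘ : Convex ℝ Θ) (hne : Θ.Nonempty) {S : ℕ → Set (EuclideanSpace ℝ (Fin d))}
    (hS : ∀ k, MeasurableSet (S k)) (h0 : θ₀ ∈ S 0) (hp : 0 ≤ p)
    (hstep : ∀ k, ∀ θ ∈ S k, (Measure.pi fun _ : Fin m => chainLaw T θ v r).real
      {x | update t z lam L Θ θ x ∉ S (k + 1)} ≤ p) (k : ℕ) :
    (iterateLaw t z lam L Θ T r m v θ₀ k).real (S k)ᶜ ≤ k * p := by
  induction k with
  | zero => simp [iterateLaw, measureReal_def, Measure.dirac_apply' _ (hS 0).compl, h0]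
  | succ k ih =>
    have hprob : IsProbabilityMeasure (iterateLaw t z lam L Θ T r m v θ₀ k) :=
      isProbabilityMeasure_iterateLaw ht hΘc hΘ hne k
    calc (iterateLaw t z lam L Θ T r m v θ₀ (k + 1)).real (S (k + 1))ᶜ
        ≤ (iterateLaw t z lam L Θ T r m v θ₀ k).real (S k)ᶜ + p :=
          measureReal_map_compProd_compl_le _ (sampleKernel T v r m)
            (measurable_update ht hΘc hΘ hne) (hS k) (hS (k + 1)) hp (hstep k)
      _ ≤ k * p + p := by gcongr
      _ = (k + 1 : ℕ) * p := by push_cast; ring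

/-- The part of `Θ` that the `k`-th iterate should have reached: a ball around `θs` whose radius
decays geometrically, at the contraction rate `γ` of an exact gradient step, from `D + b` to the
radius `b` caused by the errors of the gradient estimates. -/
def approachRegion (Θ : Set (EuclideanSpace ℝ (Fin d))) (θs : EuclideanSpace ℝ (Fin d))
    (γ D b : ℝ) (k : ℕ) : Set (EuclideanSpace ℝ (Fin d)) :=
  {θ ∈ Θ | ‖θ - θs‖ ≤ γ ^ k * D + b}

theorem measurableSet_approachRegion (hΘc : IsClosed Θ) (θs : EuclideanSpace ℝ (Fin d))
    (γ D b : ℝ) (k : ℕ) : MeasurableSet (approachRegion Θ θs γ D b k) :=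
  hΘc.measurableSet.inter
    (measurableSet_le (f := fun θ => ‖θ - θs‖) (by fun_prop) measurable_const)

end Iterates

section Accuracy

variable {X : Type*} [MeasurableSpace X] {d n m v : ℕ} {ν : Measure X} [IsFiniteMeasure ν]
  [NeZero ν] {t : X → EuclideanSpace ℝ (Fin d)} {R : ℝ} {z : Fin n → X} {lam L : ℝ}
  {Θ : Set (EuclideanSpace ℝ (Fin d))} {θ₀ θs : EuclideanSpace ℝ (Fin d)}
  {T : Kernel (EuclideanSpace ℝ (Fin d) × X) X} [IsMarkovKernel T]
  {r : Measure X} [IsProbabilityMeasure r] {D b p τ : ℝ}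

theorem norm_sampleMean_sub_integral_expFamily_le (ht : Measurable t) (hR : ∀ x, ‖t x‖ ≤ R)
    (q : Measure X) [IsProbabilityMeasure q] (θ : EuclideanSpace ℝ (Fin d)) (x : Fin m → X) :
    ‖sampleMean t x - ∫ y, t y ∂(expFamily ν t θ)‖
      ≤ ‖sampleMean t x - ∫ y, t y ∂q‖ + 2 * R * tvDist q (expFamily ν t θ) := by
  have hprob := isProbabilityMeasure_expFamily (ν := ν) ht hR θ
  exact (norm_sub_le_norm_sub_add_norm_sub _ _ _).trans
    (add_le_add_right (norm_integral_sub_integral_le_mul_tvDist _ _ ht hR) _)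

theorem update_mem_approachRegion (ht : Measurable t) (hR : ∀ x, ‖t x‖ ≤ R) (hn : 0 < n)
    (hL : 0 < L) (hle : lam ≤ L)
    (hLip : ∀ θ φ : EuclideanSpace ℝ (Fin d), ‖gradient (regNegLogLik ν t z lam) θ -
      gradient (regNegLogLik ν t z lam) φ‖ ≤ L * ‖θ - φ‖)
    (hΘc : IsClosed Θ) (hΘ : Convex ℝ Θ) (hθs : θs ∈ Θ)
    (hmin : IsMinOn (regNegLogLik ν t z lam) Θ θs) {k : ℕ} {θ : EuclideanSpace ℝ (Fin d)}
    (hθ : θ ∈ approachRegion Θ θs (1 - lam / L) D b k) {x : Fin m → X}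
    (hx : ‖sampleMean t x - ∫ y, t y ∂(expFamily ν t θ)‖ ≤ lam * b) :
    update t z lam L Θ θ x ∈ approachRegion Θ θs (1 - lam / L) D b (k + 1) := by
  have hγ : 0 ≤ 1 - lam / L := sub_nonneg.2 ((div_le_one hL).2 hle)
  refine ⟨proj_mem hΘc ⟨θs, hθs⟩ _, ?_⟩
  calc ‖update t z lam L Θ θ x - θs‖
      ≤ (1 - lam / L) * ‖θ - θs‖
          + 1 / L * ‖sampleMean t x - ∫ y, t y ∂(expFamily ν t θ)‖ :=
        norm_update_sub_le (hasGradientAt_regNegLogLik ht hR hn z lam θs)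
          (hasQuadraticLowerModel_regNegLogLik ht hR hn z lam)
          (hasQuadraticUpperModel_regNegLogLik ht hR hn z hLip) hL hle hΘc hΘ hθs hmin θ x
    _ ≤ (1 - lam / L) * ((1 - lam / L) ^ k * D + b) + 1 / L * (lam * b) := by
        gcongr
        exact hθ.2
    _ = (1 - lam / L) ^ (k + 1) * D + b := by ring

theorem measureReal_update_notMem_approachRegion_le (ht : Measurable t)
    (hR : ∀ x, ‖t x‖ ≤ R) (hn : 0 < n) (hL : 0 < L) (hle : lam ≤ L)
    (hLip : ∀ θ φ : EuclideanSpace ℝ (Fin d), ‖gradient (regNegLogLik ν t z lam) θ -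
      gradient (regNegLogLik ν t z lam) φ‖ ≤ L * ‖θ - φ‖)
    (hΘc : IsClosed Θ) (hΘ : Convex ℝ Θ) (hθs : θs ∈ Θ)
    (hmin : IsMinOn (regNegLogLik ν t z lam) Θ θs) (hm : m ≠ 0) (hp : 0 < p) {k : ℕ}
    {θ : EuclideanSpace ℝ (Fin d)} (hθ : θ ∈ approachRegion Θ θs (1 - lam / L) D b k)
    (q : Measure X) [IsProbabilityMeasure q]
    (hb : R / √m * (1 + √(2 * Real.log (1 / p))) + 2 * R * tvDist q (expFamily ν t θ)
      ≤ lam * b) :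
    (Measure.pi fun _ : Fin m => q).real
      {x | update t z lam L Θ θ x ∉ approachRegion Θ θs (1 - lam / L) D b (k + 1)} ≤ p := by
  refine (measureReal_mono fun x hx => ?_).trans
    (measureReal_lt_norm_sampleMean_sub_le q ht hR hm hp)
  by_contra hnoise
  rw [Set.mem_ofPred_eq, not_lt] at hnoise
  exact hx (update_mem_approachRegion ht hR hn hL hle hLip hΘc hΘ hθs hmin hθ <|
    (norm_sampleMean_sub_integral_expFamily_le ht hR q θ x).trans
      ((add_le_add_left hnoise _).trans hb))

theorem one_sub_mul_le_measureReal_iterateLaw (ht : Measurable t) (hR : ∀ x, ‖t x‖ ≤ R)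
    (hn : 0 < n) (hL : 0 < L) (hle : lam ≤ L)
    (hLip : ∀ θ φ : EuclideanSpace ℝ (Fin d), ‖gradient (regNegLogLik ν t z lam) θ -
      gradient (regNegLogLik ν t z lam) φ‖ ≤ L * ‖θ - φ‖)
    (hΘc : IsClosed Θ) (hΘ : Convex ℝ Θ) (hθ₀ : θ₀ ∈ Θ) (hθs : θs ∈ Θ)
    (hmin : IsMinOn (regNegLogLik ν t z lam) Θ θs) (hm : m ≠ 0) (hp : 0 < p)
    (hb₀ : 0 ≤ b)
    (hb : ∀ θ ∈ Θ, R / √m * (1 + √(2 * Real.log (1 / p)))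
      + 2 * R * tvDist (chainLaw T θ v r) (expFamily ν t θ) ≤ lam * b) (k : ℕ) :
    1 - k * p ≤ (iterateLaw t z lam L Θ T r m v θ₀ k).real
      {θ | ‖θ - θs‖ ≤ (1 - lam / L) ^ k * ‖θ₀ - θs‖ + b} := by
  let S := approachRegion Θ θs (1 - lam / L) ‖θ₀ - θs‖ b
  have hSmeas (k : ℕ) : MeasurableSet (S k) := measurableSet_approachRegion hΘc θs _ _ b k
  have hstart : θ₀ ∈ S 0 := ⟨hθ₀, by simpa using hb₀⟩
  have hprob : IsProbabilityMeasure (iterateLaw t z lam L Θ T r m v θ₀ k) :=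
    isProbabilityMeasure_iterateLaw ht hΘc hΘ ⟨θ₀, hθ₀⟩ k
  have hfail : (iterateLaw t z lam L Θ T r m v θ₀ k).real (S k)ᶜ ≤ k * p :=
    measureReal_iterateLaw_compl_le ht hΘc hΘ ⟨θ₀, hθ₀⟩ hSmeas hstart hp.le
      (fun j θ hθ => measureReal_update_notMem_approachRegion_le ht hR hn hL hle hLip hΘc hΘ
        hθs hmin hm hp hθ _ (hb θ hθ.1)) k
  rw [probReal_compl_eq_one_sub (hSmeas k)] at hfail
  exact (sub_le_comm.1 hfail).trans (measureReal_mono fun θ hθ => hθ.2)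

end Accuracy

section Schedule

variable {L l R lam D β β₁ β₂ β₃ ε δ C α c : ℝ} {K M v : ℕ}

theorem one_sub_pow_mul_le_of_stepBound_le (hL : 0 < L) (hlam : 0 < lam) (hle : lam ≤ L)
    (hD : 0 ≤ D) (hβ : 0 < β) (hε : 0 < ε) (hK : stepBound L lam D β ε ≤ K) :
    (1 - lam / L) ^ K * D ≤ β * ε := by
  rcases hD.eq_or_lt with rfl | hD
  · simpa only [mul_zero] using (mul_pos hβ hε).le
  have hγ : 0 ≤ 1 - lam / L := sub_nonneg.2 ((div_le_one hL).2 hle)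
  have hlog : Real.log (D / (β * ε)) ≤ K * (lam / L) := by
    rw [stepBound, div_mul_eq_mul_div, div_le_iff₀ hlam] at hK
    rw [← mul_div_assoc, le_div_iff₀ hL]
    linarith
  have hD' : D ≤ β * ε * Real.exp (K * (lam / L)) := by
    rwa [Real.log_le_iff_le_exp (by positivity), div_le_iff₀' (by positivity)] at hlog
  calc (1 - lam / L) ^ K * D
      ≤ Real.exp (-(lam / L)) ^ K * (β * ε * Real.exp (K * (lam / L))) := by
        gcongr
        exact Real.one_sub_le_exp_neg _
    _ = β * ε := by
        rw [← Real.exp_nat_mul, mul_left_comm, ← Real.exp_add, mul_neg, neg_add_cancel,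
          Real.exp_zero, mul_one]

theorem noise_le_of_sampleBound_le {K : ℝ} (hR : 0 ≤ R) (hlR : 2 * R ≤ l ^ 2) (hlam : 0 < lam)
    (hβ : 0 < β) (hε : 0 < ε) (hM : M ≠ 0) (h : sampleBound l R lam β ε δ K ≤ M) :
    R / √M * (1 + √(2 * Real.log (K / δ))) ≤ β * ε * lam := by
  rw [sampleBound] at h
  set s := 1 + √(2 * Real.log (K / δ))
  have hM0 : (0 : ℝ) < M := Nat.cast_pos.2 (Nat.pos_of_ne_zero hM)
  have hsq : (R / √M * s) ^ 2 ≤ (β * ε * lam) ^ 2 := by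
    rw [div_mul_eq_mul_div, div_le_iff₀ (by positivity)] at h
    rw [mul_pow, div_pow, Real.sq_sqrt hM0.le, div_mul_eq_mul_div, div_le_iff₀ hM0]
    linarith [mul_le_mul_of_nonneg_right hlR (by positivity : 0 ≤ R * s ^ 2)]
  exact le_of_sq_le_sq hsq (by positivity)

theorem pow_le_exp_neg_one_sub_mul (hα : 0 ≤ α) (v : ℕ) :
    α ^ v ≤ Real.exp (-((1 - α) * v)) := by
  calc α ^ v ≤ Real.exp (-(1 - α)) ^ v := by
        gcongr
        linarith [Real.one_sub_le_exp_neg (1 - α)]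
    _ = Real.exp (-((1 - α) * v)) := by
        rw [← Real.exp_nat_mul, mul_neg, mul_comm]

theorem bias_le_of_transitionBound_le (hl : 1 ≤ l) (hlam : 0 < lam) (hβ : 0 < β) (hε : 0 < ε)
    (hα₀ : 0 ≤ α) (hα₁ : α < 1) (h : transitionBound l R lam β ε C α ≤ v) :
    2 * R * (C * α ^ v) ≤ β * ε * lam := by
  have hb : 0 < β * ε * lam := by positivity
  rcases le_or_gt (R * C) 0 with hRC | hRC
  · linarith [mul_nonpos_of_nonpos_of_nonneg hRC (pow_nonneg hα₀ v)]
  have hpos : 0 < 2 * l * R * C := by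
    rw [mul_assoc]
    positivity
  have hlog : Real.log (2 * l * R * C / (β * ε * lam)) ≤ (1 - α) * v := by
    rwa [transitionBound, one_div, inv_mul_le_iff₀ (sub_pos.2 hα₁)] at h
  rw [Real.log_le_iff_le_exp (by positivity), div_le_iff₀ hb] at hlog
  calc 2 * R * (C * α ^ v)
      = 1 * (2 * (R * C)) * α ^ v := by ring
    _ ≤ l * (2 * (R * C)) * α ^ v := by gcongr
    _ = 2 * l * R * C * α ^ v := by ring
    _ ≤ Real.exp ((1 - α) * v) * (β * ε * lam) * Real.exp (-((1 - α) * v)) := by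
        gcongr
        exact pow_le_exp_neg_one_sub_mul hα₀ v
    _ = β * ε * lam := by
        rw [mul_right_comm, ← Real.exp_add, add_neg_cancel, Real.exp_zero, one_mul]

theorem sampleBound_mono {a b : ℝ} (hR : 0 ≤ R) (hδ : 0 < δ) (ha : 0 < a) (hab : a ≤ b) :
    sampleBound l R lam β ε δ a ≤ sampleBound l R lam β ε δ b := by
  have hlog : Real.log (a / δ) ≤ Real.log (b / δ) :=
    Real.log_le_log (by positivity) (by gcongr)
  rw [sampleBound, sampleBound]
  gcongr

theorem sampleBound_nonneg {K : ℝ} (hR : 0 ≤ R) : 0 ≤ sampleBound l R lam β ε δ K := by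
  rw [sampleBound]
  positivity

theorem one_le_effLip (L R : ℝ) : 1 ≤ effLip L R :=
  (le_max_left _ _).trans (le_max_right _ _)

theorem two_mul_le_effLip_sq (L : ℝ) {R : ℝ} (hR : 0 ≤ R) : 2 * R ≤ effLip L R ^ 2 := by
  have h : √(2 * R) ≤ effLip L R := (le_max_right _ _).trans (le_max_right _ _)
  calc 2 * R = √(2 * R) ^ 2 := (Real.sq_sqrt (by positivity)).symm
    _ ≤ effLip L R ^ 2 := by gcongr

theorem stepBound_mul_sampleBound_mul_transitionBound (L l R lam D β₁ β₂ β₃ ε δ C α c : ℝ) :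
    c * stepBound L lam D β₁ ε * (c * sampleBound l R lam β₂ ε δ (c * stepBound L lam D β₁ ε))
        * (c * transitionBound l R lam β₃ ε C α)
      = c ^ 3 * (L * l ^ 2 * R / (2 * ε ^ 2 * β₂ ^ 2 * lam ^ 3 * (1 - α)) *
        Real.log (D / (β₁ * ε)) *
        (1 + √(2 * Real.log (c * (L / (lam * δ) * Real.log (D / (β₁ * ε)))))) ^ 2 *
        Real.log (2 * l * R * C / (β₃ * ε * lam))) := by
  have harg : c * stepBound L lam D β₁ ε / δ
      = c * (L / (lam * δ) * Real.log (D / (β₁ * ε))) := by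
    rw [stepBound]
    ring
  rw [sampleBound, harg, stepBound, transitionBound]
  generalize 1 - α = ω
  ring

theorem work_le (hR : 0 ≤ R) (hδ : 0 < δ) (hc : 0 ≤ c) (hK1 : 1 ≤ K)
    (hK : K ≤ c * stepBound L lam D β₁ ε) (hM : M ≤ c * sampleBound l R lam β₂ ε δ K)
    (hv : v ≤ c * transitionBound l R lam β₃ ε C α) :
    (K * M * v : ℝ) ≤ c ^ 3 * (L * l ^ 2 * R / (2 * ε ^ 2 * β₂ ^ 2 * lam ^ 3 * (1 - α)) *
      Real.log (D / (β₁ * ε)) *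
      (1 + √(2 * Real.log (c * (L / (lam * δ) * Real.log (D / (β₁ * ε)))))) ^ 2 *
      Real.log (2 * l * R * C / (β₃ * ε * lam))) := by
  have hK0 : (0 : ℝ) < K := Nat.cast_pos.2 hK1
  have hsample : sampleBound l R lam β₂ ε δ K
      ≤ sampleBound l R lam β₂ ε δ (c * stepBound L lam D β₁ ε) :=
    sampleBound_mono hR hδ hK0 hK
  have hM' : (M : ℝ) ≤ c * sampleBound l R lam β₂ ε δ (c * stepBound L lam D β₁ ε) :=
    hM.trans (by gcongr)
  rw [← stepBound_mul_sampleBound_mul_transitionBound]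
  have hstep0 := hK0.le.trans hK
  have hsample0 := M.cast_nonneg.trans hM'
  gcongr

theorem natCeil_le_max_zero_add_one (x : ℝ) : (⌈x⌉₊ : ℝ) ≤ max 0 x + 1 := by
  calc (⌈x⌉₊ : ℝ) ≤ (⌈max 0 x⌉₊ : ℝ) := Nat.cast_le.2 (Nat.ceil_mono (le_max_right _ _))
    _ ≤ max 0 x + 1 := (Nat.ceil_lt_add_one (le_max_left _ _)).le

theorem max_one_natCeil_le_max_zero_add_one (x : ℝ) :
    ((max 1 ⌈x⌉₊ : ℕ) : ℝ) ≤ max 0 x + 1 := by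
  rw [Nat.cast_max, Nat.cast_one]
  exact max_le (le_add_of_nonneg_left (le_max_left _ _)) (natCeil_le_max_zero_add_one x)

theorem work_natCeil_le {κ η : ℝ} (hR : 0 ≤ R) (hδ : 0 < δ) (hK : K = max 1 ⌈κ⌉₊)
    (hM : M = max 1 ⌈sampleBound l R lam β ε δ K⌉₊) (hv : v = ⌈η⌉₊) :
    (K * M * v : ℝ) ≤ (max 0 κ + 1) * (sampleBound l R lam β ε δ (max 0 κ + 1) + 1)
      * (max 0 η + 1) := by
  have hK' : (K : ℝ) ≤ max 0 κ + 1 := hK ▸ max_one_natCeil_le_max_zero_add_one κ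
  have hK0 : (0 : ℝ) < K := Nat.cast_pos.2 (hK ▸ Nat.le_max_left 1 _)
  have hM' : (M : ℝ) ≤ sampleBound l R lam β ε δ (max 0 κ + 1) + 1 :=
    calc (M : ℝ) ≤ max 0 (sampleBound l R lam β ε δ K) + 1 :=
          hM ▸ max_one_natCeil_le_max_zero_add_one _
      _ = sampleBound l R lam β ε δ K + 1 := by rw [max_eq_right (sampleBound_nonneg hR)]
      _ ≤ sampleBound l R lam β ε δ (max 0 κ + 1) + 1 := by
          gcongr
          exact sampleBound_mono hR hδ hK0 hK'
  have hv' : (v : ℝ) ≤ max 0 η + 1 := hv ▸ natCeil_le_max_zero_add_one η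
  have hsample := sampleBound_nonneg (l := l) (lam := lam) (β := β) (ε := ε) (δ := δ)
    (K := max 0 κ + 1) hR
  gcongr

end Schedule

section ScheduleAccuracy

variable {X : Type*} [MeasurableSpace X] {d n : ℕ} {ν : Measure X} [IsFiniteMeasure ν]
  [NeZero ν] {t : X → EuclideanSpace ℝ (Fin d)} {R : ℝ} {z : Fin n → X} {lam L : ℝ}
  {Θ : Set (EuclideanSpace ℝ (Fin d))} {θ₀ θs : EuclideanSpace ℝ (Fin d)}
  {T : Kernel (EuclideanSpace ℝ (Fin d) × X) X} [IsMarkovKernel T]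
  {r : Measure X} [IsProbabilityMeasure r] {C α ε δ β₁ β₂ β₃ : ℝ} {K M v : ℕ}

theorem one_sub_le_measureReal_iterateLaw (ht : Measurable t) (hR : ∀ x, ‖t x‖ ≤ R)
    (hn : 0 < n) (hlam : 0 < lam) (hL : 0 < L)
    (hLip : ∀ θ φ : EuclideanSpace ℝ (Fin d), ‖gradient (regNegLogLik ν t z lam) θ -
      gradient (regNegLogLik ν t z lam) φ‖ ≤ L * ‖θ - φ‖)
    (hΘc : IsClosed Θ) (hΘ : Convex ℝ Θ) (hθ₀ : θ₀ ∈ Θ) (hθs : θs ∈ Θ)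
    (hmin : IsMinOn (regNegLogLik ν t z lam) Θ θs) (hα₀ : 0 ≤ α) (hα₁ : α < 1)
    (hmix : ∀ θ ∈ Θ, tvDist (chainLaw T θ v r) (expFamily ν t θ) ≤ C * α ^ v)
    (hε : 0 < ε) (hδ : 0 < δ) (hβ₁ : 0 < β₁) (hβ₂ : 0 < β₂) (hβ₃ : 0 < β₃)
    (hβ : β₁ + β₂ + β₃ = 1) (hK0 : K ≠ 0) (hM0 : M ≠ 0)
    (hK : stepBound L lam ‖θ₀ - θs‖ β₁ ε ≤ K)
    (hM : sampleBound (effLip L R) R lam β₂ ε δ K ≤ M)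
    (hv : transitionBound (effLip L R) R lam β₃ ε C α ≤ v) :
    1 - δ ≤ (iterateLaw t z lam L Θ T r M v θ₀ K).real {θ | ‖θ - θs‖ ≤ ε} := by
  have hprob : IsProbabilityMeasure (iterateLaw t z lam L Θ T r M v θ₀ K) :=
    isProbabilityMeasure_iterateLaw ht hΘc hΘ ⟨θ₀, hθ₀⟩ K
  rcases subsingleton_or_nontrivial (EuclideanSpace ℝ (Fin d)) with hsub | hnontriv
  · have huniv : {θ | ‖θ - θs‖ ≤ ε} = Set.univ :=
      Set.eq_univ_of_forall fun θ => by simp [Subsingleton.elim θ θs, hε.le]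
    rw [huniv, probReal_univ]
    exact sub_le_self _ hδ.le
  have hle : lam ≤ L :=
    (hasQuadraticLowerModel_regNegLogLik ht hR hn z lam).le_of_hasQuadraticUpperModel
      (hasQuadraticUpperModel_regNegLogLik ht hR hn z hLip)
  have hR0 : 0 ≤ R := (norm_nonneg _).trans (hR (z ⟨0, hn⟩))
  have hKpos : (0 : ℝ) < K := Nat.cast_pos.2 (Nat.pos_of_ne_zero hK0)
  have hbudget (θ) (hθ : θ ∈ Θ) : R / √M * (1 + √(2 * Real.log (1 / (δ / K))))
      + 2 * R * tvDist (chainLaw T θ v r) (expFamily ν t θ) ≤ lam * ((β₂ + β₃) * ε) :=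
    calc _ ≤ R / √M * (1 + √(2 * Real.log (K / δ))) + 2 * R * (C * α ^ v) := by
          rw [one_div_div]
          gcongr
          exact hmix θ hθ
      _ ≤ β₂ * ε * lam + β₃ * ε * lam := add_le_add
          (noise_le_of_sampleBound_le hR0 (two_mul_le_effLip_sq L hR0) hlam hβ₂ hε hM0 hM)
          (bias_le_of_transitionBound_le (one_le_effLip L R) hlam hβ₃ hε hα₀ hα₁ hv)
      _ = lam * ((β₂ + β₃) * ε) := by ring
  have hradius : (1 - lam / L) ^ K * ‖θ₀ - θs‖ + (β₂ + β₃) * ε ≤ ε :=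
    calc _ ≤ β₁ * ε + (β₂ + β₃) * ε := add_le_add_left
          (one_sub_pow_mul_le_of_stepBound_le hL hlam hle (norm_nonneg _) hβ₁ hε hK) _
      _ = ε := by rw [← add_mul, ← add_assoc, hβ, one_mul]
  have hball := one_sub_mul_le_measureReal_iterateLaw ht hR hn hL hle hLip hΘc hΘ hθ₀ hθs hmin
    hM0 (div_pos hδ hKpos) (by positivity) hbudget K
  rw [mul_div_cancel₀ _ hKpos.ne'] at hball
  exact hball.trans (measureReal_mono fun θ hθ => le_trans hθ hradius)

end ScheduleAccuracy

end MCMCLearn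

open MCMCLearn in
theorem mainTheorem5_general {X : Type*} [MeasurableSpace X] {d n : ℕ}
    {ν : Measure X} [IsFiniteMeasure ν] [NeZero ν]
    {t : X → EuclideanSpace ℝ (Fin d)} (ht : Measurable t) {R₂ : ℝ} (hR₂ : ∀ x, ‖t x‖ ≤ R₂)
    (hn : 0 < n) {z : Fin n → X} {lam : ℝ} (hlam : 0 < lam) {L : ℝ} (hL : 0 < L)
    (hLip : ∀ θ φ : EuclideanSpace ℝ (Fin d),
      ‖gradient (regNegLogLik ν t z lam) θ - gradient (regNegLogLik ν t z lam) φ‖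
        ≤ L * ‖θ - φ‖)
    {Θ : Set (EuclideanSpace ℝ (Fin d))} (hΘc : IsClosed Θ) (hΘ : Convex ℝ Θ)
    {θ₀ : EuclideanSpace ℝ (Fin d)} (hθ₀ : θ₀ ∈ Θ)
    {θs : EuclideanSpace ℝ (Fin d)} (hθs : θs ∈ Θ) (hmin : IsMinOn (regNegLogLik ν t z lam) Θ θs)
    {T : Kernel (EuclideanSpace ℝ (Fin d) × X) X} [IsMarkovKernel T]
    {r : Measure X} [IsProbabilityMeasure r] {C α : ℝ} (hα₀ : 0 ≤ α) (hα₁ : α < 1)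
    (hmix : ∀ θ ∈ Θ, ∀ v : ℕ, tvDist (chainLaw T θ v r) (expFamily ν t θ) ≤ C * α ^ v)
    {ε : ℝ} (hε : 0 < ε) {δ : ℝ} (hδ : 0 < δ)
    {β₁ β₂ β₃ : ℝ} (hβ₁ : 0 < β₁) (hβ₂ : 0 < β₂) (hβ₃ : 0 < β₃) (hβ : β₁ + β₂ + β₃ = 1) :
    (∀ K M v : ℕ, 1 ≤ K → 1 ≤ M →
      stepBound L lam ‖θ₀ - θs‖ β₁ ε ≤ K →
      sampleBound (effLip L R₂) R₂ lam β₂ ε δ K ≤ M →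
      transitionBound (effLip L R₂) R₂ lam β₃ ε C α ≤ v →
      1 - δ ≤ (iterateLaw t z lam L Θ T r M v θ₀ K).real {θ | ‖θ - θs‖ ≤ ε}) ∧
    (∀ (c : ℝ) (K M v : ℕ), 0 ≤ c → 1 ≤ K →
      K ≤ c * stepBound L lam ‖θ₀ - θs‖ β₁ ε →
      M ≤ c * sampleBound (effLip L R₂) R₂ lam β₂ ε δ K →
      v ≤ c * transitionBound (effLip L R₂) R₂ lam β₃ ε C α →
      (K * M * v : ℝ) ≤
        c ^ 3 * (L * effLip L R₂ ^ 2 * R₂ / (2 * ε ^ 2 * β₂ ^ 2 * lam ^ 3 * (1 - α)) *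
          Real.log (‖θ₀ - θs‖ / (β₁ * ε)) *
          (1 + √(2 * Real.log (c * (L / (lam * δ) * Real.log (‖θ₀ - θs‖ / (β₁ * ε)))))) ^ 2 *
          Real.log (2 * effLip L R₂ * R₂ * C / (β₃ * ε * lam)))) ∧
    (∀ K M v : ℕ,
      K = max 1 ⌈stepBound L lam ‖θ₀ - θs‖ β₁ ε⌉₊ →
      M = max 1 ⌈sampleBound (effLip L R₂) R₂ lam β₂ ε δ K⌉₊ →
      v = ⌈transitionBound (effLip L R₂) R₂ lam β₃ ε C α⌉₊ →
      (K * M * v : ℝ) ≤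
        (max 0 (stepBound L lam ‖θ₀ - θs‖ β₁ ε) + 1) *
        (sampleBound (effLip L R₂) R₂ lam β₂ ε δ
          (max 0 (stepBound L lam ‖θ₀ - θs‖ β₁ ε) + 1) + 1) *
        (max 0 (transitionBound (effLip L R₂) R₂ lam β₃ ε C α) + 1)) := by
  have hR0 : 0 ≤ R₂ := (norm_nonneg _).trans (hR₂ (z ⟨0, hn⟩))
  refine ⟨fun K M v hK₁ hM₁ hK hM hv => ?_, fun c K M v hc hK₁ hK hM hv => ?_,
    fun K M v hK hM hv => ?_⟩
  · exact one_sub_le_measureReal_iterateLaw ht hR₂ hn hlam hL hLip hΘc hΘ hθ₀ hθs hmin hα₀ hα₁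
      (fun θ hθ => hmix θ hθ v) hε hδ hβ₁ hβ₂ hβ₃ hβ (Nat.one_le_iff_ne_zero.1 hK₁)
      (Nat.one_le_iff_ne_zero.1 hM₁) hK hM hv
  · exact work_le hR0 hδ hc hK₁ hK hM hv
  · exact work_natCeil_le hR0 hδ hK hM hv

theorem mainTheorem5
    {X : Type*} [MeasurableSpace X] {d n : ℕ}
    -- the exponential family, with bounded sufficient statistics
    (ν : MeasureTheory.Measure X) [MeasureTheory.IsFiniteMeasure ν] [NeZero ν]
    (t : X → EuclideanSpace ℝ (Fin d)) (ht : Measurable t)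
    (R₂ : ℝ) (hR₂ : ∀ x, ‖t x‖ ≤ R₂)
    -- the data set and the regularization
    (hn : 0 < n) (z : Fin n → X) (lam : ℝ) (hlam : 0 < lam)
    -- the Lipschitz constant of the gradient of the objective
    (L : ℝ) (hL : 0 < L)
    (hLip : ∀ θ φ : EuclideanSpace ℝ (Fin d),
      ‖gradient (MCMCLearn.regNegLogLik ν t z lam) θ -
        gradient (MCMCLearn.regNegLogLik ν t z lam) φ‖ ≤ L * ‖θ - φ‖)
    -- the constraint set, the starting point and the constrained minimizer
    (Θ : Set (EuclideanSpace ℝ (Fin d))) (hΘc : IsClosed Θ) (hΘ : Convex ℝ Θ)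
    (θ₀ : EuclideanSpace ℝ (Fin d)) (hθ₀ : θ₀ ∈ Θ)
    (θs : EuclideanSpace ℝ (Fin d)) (hθs : θs ∈ Θ)
    (hmin : IsMinOn (MCMCLearn.regNegLogLik ν t z lam) Θ θs)
    -- the Markov chains, which are fast mixing on the constraint set
    (T : ProbabilityTheory.Kernel (EuclideanSpace ℝ (Fin d) × X) X)
    [ProbabilityTheory.IsMarkovKernel T]
    (C α : ℝ) (hα₀ : 0 < α) (hα₁ : α < 1)
    (hmix : ∀ θ ∈ Θ, ∀ q : MeasureTheory.Measure X, MeasureTheory.IsProbabilityMeasure q →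
      ∀ v : ℕ, MCMCLearn.tvDist (MCMCLearn.chainLaw T θ v q) (MCMCLearn.expFamily ν t θ)
        ≤ C * α ^ v)
    -- the distribution from which the chains are started
    (r : MeasureTheory.Measure X) [MeasureTheory.IsProbabilityMeasure r]
    -- the accuracy, the failure probability and the weights
    (ε : ℝ) (hε : 0 < ε) (δ : ℝ) (hδ₀ : 0 < δ) (hδ₁ : δ < 1)
    (β₁ β₂ β₃ : ℝ) (hβ₁ : 0 < β₁) (hβ₂ : 0 < β₂) (hβ₃ : 0 < β₃) (hβ : β₁ + β₂ + β₃ = 1) :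
    -- the accuracy guarantee under the schedule
    (∀ K M v : ℕ, 1 ≤ K → 1 ≤ M →
      MCMCLearn.stepBound L lam ‖θ₀ - θs‖ β₁ ε ≤ K →
      MCMCLearn.sampleBound (MCMCLearn.effLip L R₂) R₂ lam β₂ ε δ K ≤ M →
      MCMCLearn.transitionBound (MCMCLearn.effLip L R₂) R₂ lam β₃ ε C α ≤ v →
      1 - δ ≤ (MCMCLearn.iterateLaw t z lam L Θ T r M v θ₀ K).real {θ | ‖θ - θs‖ ≤ ε}) ∧
    -- the total work, if the schedule is met up to a factor `c` (the case `c = 1` is equality)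
    (∀ (c : ℝ) (K M v : ℕ), 1 ≤ c → 1 ≤ K →
      K ≤ c * MCMCLearn.stepBound L lam ‖θ₀ - θs‖ β₁ ε →
      M ≤ c * MCMCLearn.sampleBound (MCMCLearn.effLip L R₂) R₂ lam β₂ ε δ K →
      v ≤ c * MCMCLearn.transitionBound (MCMCLearn.effLip L R₂) R₂ lam β₃ ε C α →
      (K * M * v : ℝ) ≤
        c ^ 3 * (L * MCMCLearn.effLip L R₂ ^ 2 * R₂ /
            (2 * ε ^ 2 * β₂ ^ 2 * lam ^ 3 * (1 - α)) *
          Real.log (‖θ₀ - θs‖ / (β₁ * ε)) *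
          (1 + √(2 * Real.log (c * (L / (lam * δ) * Real.log (‖θ₀ - θs‖ / (β₁ * ε)))))) ^ 2 *
          Real.log (2 * MCMCLearn.effLip L R₂ * R₂ * C / (β₃ * ε * lam)))) ∧
    -- the total work of the smallest integers that meet the schedule
    (∀ K M v : ℕ,
      K = max 1 ⌈MCMCLearn.stepBound L lam ‖θ₀ - θs‖ β₁ ε⌉₊ →
      M = max 1 ⌈MCMCLearn.sampleBound (MCMCLearn.effLip L R₂) R₂ lam β₂ ε δ K⌉₊ →
      v = ⌈MCMCLearn.transitionBound (MCMCLearn.effLip L R₂) R₂ lam β₃ ε C α⌉₊ →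
      (K * M * v : ℝ) ≤
        (max 0 (MCMCLearn.stepBound L lam ‖θ₀ - θs‖ β₁ ε) + 1) *
        (MCMCLearn.sampleBound (MCMCLearn.effLip L R₂) R₂ lam β₂ ε δ
          (max 0 (MCMCLearn.stepBound L lam ‖θ₀ - θs‖ β₁ ε) + 1) + 1) *
        (max 0 (MCMCLearn.transitionBound (MCMCLearn.effLip L R₂) R₂ lam β₃ ε C α) + 1)) := by
  have h := mainTheorem5_general ht hR₂ hn hlam hL hLip hΘc hΘ hθ₀ hθs hmin hα₀.le hα₁
    (fun θ hθ v => hmix θ hθ r inferInstance v) hε hδ₀ hβ₁ hβ₂ hβ₃ hβ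
  exact ⟨h.1, fun c K M v hc => h.2.1 c K M v (zero_le_one.trans hc), h.2.2⟩
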